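/- **Model.** There are $M\ge 1$ messages and $K\ge 1$ contexts. In each of the timeslots $t=1,\dots,T$ a group of $N\ge 1$ users arrives; user $n$ has a context $x_t(n)\in[1:K]$. The $N$ users are divided (at random or not) into $\tau$ subgroups $\mathcal N_{1},\dots,\mathcal N_{\tau}$ whose sizes are $N/\tau$ (rounded down, or the integer after that, if $\tau\nmid N$); the divisions of different timeslots are i.i.d. and independent of the contexts. The server observes the contexts and the subgroups, sends one message to each subgroup ($\tau$ broadcast transmissions, $1\le\tau\le N$), and then observes the payoff of every user. A user with context $k$ who is served message $m$ yields a payoff in $[0,1]$ drawn, independently over users and timeslots, from an unknown distribution $\mathcal P_{k,m}$ with mean $\mu(k,m)$. All the means are positive integer multiples of some $\Delta\ge\underline\Delta$, where $\underline\Delta>0$ is known. *Uniform context arrivals* means that the contexts of all users in all timeslots are independent and uniform on $[1:K]$. The learning regret of an online strategy, which serves user $n$ in timeslot $t$ the message $a_t(n)$ and thereby obtains the payoff $r_t(n)$, is $$R(T)=\mathbb E\sum_{t=1}^{T}\Big[\sum_{s=1}^{\tau}\max_{m\in[1:M]}\sum_{n\in\mathcal N_s}\mu(x_t(n),m)-\sum_{n=1}^{N}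 r_t(n)\Big].$$ **Theorem.** For every $\underline\Delta>0$ there is a constant $C>0$, depending only on $\underline\Delta$, such that the following holds for all $M,N,K,\tau,T$ under uniform context arrivals. 1. Let $1\le\tau<N$ and $F=\frac{MN^2K}{\tau^2}\log(MNKT)$. If $F\ge N$, there is an online strategy (depending on $M,N,K,\tau,T,\underline\Delta$ but not on the unknown distributions) whose learning regret satisfies $R(T)\le C\,\frac{MN^2K}{\tau^2}\log(MNKT)$ for all payoff distributions and all rules of division as above. 2. Let $\tau=N$ and $F=MK\log(NT/K)$. If $F\ge N$ and $NT\ge 2K$, there is likewise an online strategy with $R(T)\le C\,MK\log(NT/K)$. The conditions on $F$ and on $NT/K$ hold for all sufficiently large $T$. The bound for $\tau$ transmissions is thus $1/\tau^2$ times that for one transmission, when $1\le\tau<N$. -/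

import Mathlib

open MeasureTheory
open scoped ENNReal

/-- A division of `N` users into `τ` subgroups (`g n` is the subgroup of user `n`) is balanced if
every subgroup has `⌊N / τ⌋` or `⌊N / τ⌋ + 1` users.  When `τ` divides `N` this forces every
subgroup to have exactly `N / τ` users. -/
def IsBalanced {N τ : ℕ} (g : Fin N → Fin τ) : Prop :=
  ∀ s : Fin τ, (Finset.univ.filter fun n => g n = s).card = N / τ ∨
    (Finset.univ.filter fun n => g n = s).card = N / τ + 1

/-- An instance of the contextual broadcast bandit with `M` messages, `N` users per timeslot, `K`
contexts and `τ` broadcast transmissions per timeslot. -/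
structure BroadcastBandit (M N K τ : ℕ) where
  /-- the law of the vector of contexts of the `N` users of one timeslot -/
  arrivals : PMF (Fin N → Fin K)
  /-- the law of the division of the users of one timeslot into `τ` subgroups -/
  split : PMF (Fin N → Fin τ)
  split_balanced : ∀ g ∈ split.support, IsBalanced g
  /-- the law of the payoff of message `m` for a user with context `k` -/
  payoff : Fin K → Fin M → Measure ℝ
  payoff_prob : ∀ k m, IsProbabilityMeasure (payoff k m)
  payoff_mem : ∀ k m, ∀ᵐ r ∂(payoff k m), r ∈ Set.Icc (0 : ℝ) 1

/-- Everything that is random in one timeslot: the contexts of the users, the division into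
subgroups, and the payoff that each user would give under each context and each message. -/
abbrev Slot (M N K τ : ℕ) : Type :=
  (Fin N → Fin K) × (Fin N → Fin τ) × (Fin N → Fin K → Fin M → ℝ)

/-- What the server knows about one completed timeslot: the contexts, the division into subgroups,
the message sent to each subgroup, and the payoff received from each user. -/
abbrev Observation (M N K τ : ℕ) : Type :=
  (Fin N → Fin K) × (Fin N → Fin τ) × (Fin τ → Fin M) × (Fin N → ℝ)

/-- An online strategy: from the observations of the completed timeslots and the current contexts
and subgroups, it picks one message for each subgroup. -/
structure Strategy (M N K τ : ℕ) where
  choose : (t : ℕ) → (Fin t → Observation M N K τ) → (Fin N → Fin K) → (Fin N → Fin τ) →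
    Fin τ → Fin M
  measurable_choose : ∀ t : ℕ, Measurable
    fun p : (Fin t → Observation M N K τ) × (Fin N → Fin K) × (Fin N → Fin τ) =>
      choose t p.1 p.2.1 p.2.2

namespace Strategy

/-- The observation that one timeslot produces when message `a s` is sent to subgroup `s`. -/
def observe {M N K τ : ℕ} (z : Slot M N K τ) (a : Fin τ → Fin M) : Observation M N K τ :=
  (z.1, z.2.1, a, fun n => z.2.2 n (z.1 n) (a (z.2.1 n)))

/-- The observations of the first `t` timeslots (numbered from `0`) along the sample path `ω`. -/
def history {M N K τ : ℕ} (π : Strategy M N K τ) (ω : ℕ → Slot M N K τ) :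
    (t : ℕ) → Fin t → Observation M N K τ
  | 0 => Fin.elim0
  | t + 1 => Fin.snoc (α := fun _ => Observation M N K τ) (history π ω t)
      (observe (ω t) (π.choose t (history π ω t) (ω t).1 (ω t).2.1))

/-- The message sent to each subgroup in timeslot `t` along the sample path `ω`. -/
def message {M N K τ : ℕ} (π : Strategy M N K τ) (ω : ℕ → Slot M N K τ) (t : ℕ) :
    Fin τ → Fin M :=
  π.choose t (π.history ω t) (ω t).1 (ω t).2.1

theorem measurable_table {M N K : ℕ} (n : Fin N) :
    Measurable fun p : (Fin N → Fin K → Fin M → ℝ) × (Fin K × Fin M) => p.1 n p.2.1 p.2.2 := by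
  refine measurable_from_prod_countable_left fun q => ?_
  exact (measurable_pi_apply q.2).comp ((measurable_pi_apply q.1).comp (measurable_pi_apply n))

theorem measurable_observe {M N K τ : ℕ} :
    Measurable fun p : Slot M N K τ × (Fin τ → Fin M) => observe p.1 p.2 := by
  unfold observe
  refine Measurable.prodMk (by fun_prop) (Measurable.prodMk (by fun_prop)
    (Measurable.prodMk (by fun_prop) ?_))
  rw [measurable_pi_iff]
  intro n
  refine (measurable_table n).comp (Measurable.prodMk (by fun_prop)
    (Measurable.prodMk (by fun_prop) ?_))
  have h : Measurable fun q : (Fin N → Fin τ) × (Fin τ → Fin M) => q.2 (q.1 n) :=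
    measurable_of_finite _
  exact h.comp (Measurable.prodMk (by fun_prop) (by fun_prop))

theorem measurable_next {M N K τ : ℕ} (π : Strategy M N K τ) (t : ℕ)
    (h : Measurable fun ω : ℕ → Slot M N K τ => π.history ω t) :
    Measurable fun ω : ℕ → Slot M N K τ => π.choose t (π.history ω t) (ω t).1 (ω t).2.1 :=
  (π.measurable_choose t).comp (h.prodMk (Measurable.prodMk (by fun_prop) (by fun_prop)))

theorem measurable_history {M N K τ : ℕ} (π : Strategy M N K τ) (t : ℕ) :
    Measurable fun ω : ℕ → Slot M N K τ => π.history ω t := by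
  induction t with
  | zero =>
    have h : (fun ω : ℕ → Slot M N K τ => π.history ω 0) = fun _ => Fin.elim0 := rfl
    rw [h]
    exact measurable_const
  | succ t ih =>
    rw [measurable_pi_iff]
    intro i
    refine Fin.lastCases ?_ (fun i => ?_) i
    · simp only [history, Fin.snoc_last]
      have h1 : Measurable fun ω : ℕ → Slot M N K τ => ω t := measurable_pi_apply t
      exact measurable_observe.comp (h1.prodMk (π.measurable_next t ih))
    · simp only [history, Fin.snoc_castSucc]
      exact (measurable_pi_apply i).comp ih

theorem measurable_message {M N K τ : ℕ} (π : Strategy M N K τ) (t : ℕ) :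
    Measurable fun ω : ℕ → Slot M N K τ => π.message ω t :=
  π.measurable_next t (π.measurable_history t)

end Strategy

namespace BroadcastBandit

/-- The expected payoff `μ(k, m)`. -/
noncomputable def mean {M N K τ : ℕ} (B : BroadcastBandit M N K τ) (k : Fin K) (m : Fin M) : ℝ :=
  ∫ r, r ∂(B.payoff k m)

/-- Uniform context arrivals: all `K ^ N` context vectors are equally likely, that is, the contexts
of the `N` users are independent and uniform on the `K` contexts. -/
def UniformArrivals {M N K τ : ℕ} (B : BroadcastBandit M N K τ) : Prop :=
  ∀ x : Fin N → Fin K, B.arrivals x = ((K : ℝ≥0∞) ^ N)⁻¹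

/-- The discrete payoff structure: all expected payoffs are positive integer multiples of one number
`Δ ≥ δ`.  (They are at most `1` because payoffs lie in `[0, 1]`.) -/
def DiscretePayoffs {M N K τ : ℕ} (B : BroadcastBandit M N K τ) (δ : ℝ) : Prop :=
  ∃ Δ : ℝ, δ ≤ Δ ∧ ∀ k m, ∃ j : ℕ, 1 ≤ j ∧ B.mean k m = j * Δ

/-- The law of one timeslot: contexts, division into subgroups and the payoffs of the different
users, contexts and messages are independent. -/
noncomputable def slotLaw {M N K τ : ℕ} (B : BroadcastBandit M N K τ) : Measure (Slot M N K τ) :=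
  B.arrivals.toMeasure.prod (B.split.toMeasure.prod
    (Measure.pi fun _ : Fin N => Measure.pi fun k : Fin K => Measure.pi fun m : Fin M =>
      B.payoff k m))

instance {M N K τ : ℕ} (B : BroadcastBandit M N K τ) : IsProbabilityMeasure B.slotLaw := by
  have := B.payoff_prob
  unfold slotLaw
  infer_instance

/-- The law of the whole process: the timeslots are independent and identically distributed. -/
noncomputable def law {M N K τ : ℕ} (B : BroadcastBandit M N K τ) :
    Measure (ℕ → Slot M N K τ) :=
  Measure.infinitePi fun _ => B.slotLaw

/-- The largest expected total payoff of the users with contexts `x`, divided into the subgroups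
`g`, when every subgroup is sent the message that is best for that subgroup. -/
noncomputable def best {M N K τ : ℕ} (B : BroadcastBandit M N K τ) (x : Fin N → Fin K)
    (g : Fin N → Fin τ) : ℝ :=
  ∑ s : Fin τ, ⨆ m : Fin M, ∑ n ∈ Finset.univ.filter (fun n => g n = s), B.mean (x n) m

/-- The payoff lost in the first `T` timeslots along the sample path `ω`. -/
noncomputable def pathRegret {M N K τ : ℕ} (B : BroadcastBandit M N K τ) (π : Strategy M N K τ)
    (T : ℕ) (ω : ℕ → Slot M N K τ) : ℝ :=
  ∑ t ∈ Finset.range T, (B.best (ω t).1 (ω t).2.1 -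
    ∑ n : Fin N, (ω t).2.2 n ((ω t).1 n) (π.message ω t ((ω t).2.1 n)))

/-- The learning regret `R(T)`. -/
noncomputable def regret {M N K τ : ℕ} (B : BroadcastBandit M N K τ) (π : Strategy M N K τ)
    (T : ℕ) : ℝ :=
  ∫ ω, B.pathRegret π T ω ∂B.law

theorem ae_payoff_mem {M N K τ : ℕ} (B : BroadcastBandit M N K τ) (t : ℕ) :
    ∀ᵐ ω ∂B.law, ∀ n k m, (ω t).2.2 n k m ∈ Set.Icc (0 : ℝ) 1 := by
  have := B.payoff_prob
  have h1 : MeasurePreserving (fun ω : ℕ → Slot M N K τ => ω t) B.law B.slotLaw :=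
    measurePreserving_eval_infinitePi (fun _ : ℕ => B.slotLaw) t
  simp only [ae_all_iff]
  intro n k m
  have h2 : Measure.QuasiMeasurePreserving (fun z : Slot M N K τ => z.2.2 n k m) B.slotLaw
      (B.payoff k m) := by
    have e1 := (measurePreserving_eval (fun m : Fin M => B.payoff k m) m).quasiMeasurePreserving
    have e2 := (measurePreserving_eval
      (fun k : Fin K => Measure.pi fun m : Fin M => B.payoff k m) k).quasiMeasurePreserving
    have e3 := (measurePreserving_eval (fun _ : Fin N => Measure.pi fun k : Fin K =>
      Measure.pi fun m : Fin M => B.payoff k m) n).quasiMeasurePreserving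
    exact e1.comp (e2.comp (e3.comp (Measure.quasiMeasurePreserving_snd.comp
      Measure.quasiMeasurePreserving_snd)))
  exact (h2.comp h1.quasiMeasurePreserving).ae (B.payoff_mem k m)

/-- The integral in `regret` is never a junk value. -/
theorem integrable_pathRegret {M N K τ : ℕ} (B : BroadcastBandit M N K τ) (π : Strategy M N K τ)
    (T : ℕ) : Integrable (B.pathRegret π T) B.law := by
  have : IsProbabilityMeasure B.law := by unfold law; infer_instance
  unfold pathRegret
  refine integrable_finsetSum _ fun t _ => Integrable.sub ?_ (integrable_finsetSum _ fun n _ => ?_)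
  · have hm : Measurable fun ω : ℕ → Slot M N K τ => ((ω t).1, (ω t).2.1) :=
      Measurable.prodMk (by fun_prop) (by fun_prop)
    have : IsProbabilityMeasure (B.law.map fun ω => ((ω t).1, (ω t).2.1)) :=
      Measure.isProbabilityMeasure_map hm.aemeasurable
    have hi : Integrable (fun p : (Fin N → Fin K) × (Fin N → Fin τ) => B.best p.1 p.2)
        (B.law.map fun ω => ((ω t).1, (ω t).2.1)) := Integrable.of_finite
    exact hi.comp_measurable hm
  · have hm : Measurable fun ω : ℕ → Slot M N K τ =>
        (ω t).2.2 n ((ω t).1 n) (π.message ω t ((ω t).2.1 n)) := by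
      have h1 : Measurable fun ω : ℕ → Slot M N K τ => ω t := measurable_pi_apply t
      have h2 : Measurable fun ω : ℕ → Slot M N K τ =>
          Strategy.observe (ω t) (π.message ω t) :=
        Strategy.measurable_observe.comp (h1.prodMk (π.measurable_message t))
      exact (measurable_pi_apply n).comp h2.snd.snd.snd
    refine Integrable.of_bound hm.aestronglyMeasurable 1 ?_
    filter_upwards [B.ae_payoff_mem t] with ω hω
    obtain ⟨h0, h1⟩ := hω n ((ω t).1 n) (π.message ω t ((ω t).2.1 n))
    rw [Real.norm_eq_abs, abs_of_nonneg h0]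
    exact h1

end BroadcastBandit

/-! Explore, then commit. Every subgroup has at most `G = N / τ + 1` users (integer division), and
the sums of means over a subgroup are integer multiples of some `Δ ≥ δ`. If every estimated mean is
off by less than `ε = δ / (2 * G)`, the estimated sums are off by less than `δ / 2`, so a maximiser
of the estimates is exactly optimal and exploitation loses nothing (`sum_mean_le_of_accurate`). A
fixed schedule sends each message to at least `q` subgroups, so about `q * N / (τ * K)` of its
recipients have a given context. A Chernoff bound that averages over the contexts as well
(`measure_scheduleDeviation_nonneg_le`) gives failure probability at most `2 * exp (-Λ)` once `q` is
about `K * Λ * (N / τ) / δ ^ 2`. This takes about `M * q / τ` timeslots of loss at most `N`, hence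
the main term `M * K * (N / τ) ^ 2 * Λ / δ ^ 2`. One factor `N / τ` is the number of users per
timeslot and transmission; the other is what remains of the precision `1 / ε ^ 2`, of order `(N / τ)
^ 2 / δ ^ 2`, after each transmission has supplied about `N / τ` samples. After exploration, the
history is independent of the current timeslot. The loss of a subgroup is charged to a user whose
context has an inaccurate estimate; under uniform contexts the sum over contexts cancels against `1
/ K`. The choice of `Λ` makes these losses negligible over `T` timeslots. -/

/-! ### Exponential moments of one payoff and counting in balanced divisions -/

theorem PMF.ae_mem_support {α : Type*} [MeasurableSpace α] [MeasurableSingletonClass α]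
    [Countable α] (p : PMF α) : ∀ᵐ a ∂p.toMeasure, a ∈ p.support := by
  rw [ae_iff, PMF.toMeasure_apply_eq_zero_iff _ (Set.to_countable _).measurableSet]
  exact Set.disjoint_left.2 fun a h h' => h' h

theorem lintegral_pi_prod {ι : Type*} [Fintype ι] {Ω : ι → Type*} [∀ i, MeasurableSpace (Ω i)]
    (μ : ∀ i, Measure (Ω i)) [∀ i, IsProbabilityMeasure (μ i)] {f : ∀ i, Ω i → ℝ≥0∞}
    (hf : ∀ i, Measurable (f i)) :
    ∫⁻ ω, ∏ i, f i (ω i) ∂Measure.pi μ = ∏ i, ∫⁻ x, f i x ∂μ i := by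
  rw [ProbabilityTheory.lintegral_prod_eq_prod_lintegral_of_indepFun Finset.univ
    (fun i (ω : ∀ i, Ω i) => f i (ω i))
    (ProbabilityTheory.iIndepFun_pi fun i => (hf i).aemeasurable) (by fun_prop)]
  exact Finset.prod_congr rfl fun i _ => (measurePreserving_eval μ i).lintegral_comp (hf i)

/-- Hoeffding's lemma at the optimal exponent, shifted by the tolerated deviation. -/
theorem lintegral_exp_deviation_le (P : Measure ℝ) [IsProbabilityMeasure P]
    (hP : ∀ᵐ r ∂P, r ∈ Set.Icc (0 : ℝ) 1) (ε σ : ℝ) (hσ : σ ^ 2 = 1) :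
    ∫⁻ r, ENNReal.ofReal (Real.exp (4 * ε * (σ * (r - ∫ r, r ∂P) - ε))) ∂P ≤
      ENNReal.ofReal (Real.exp (-2 * ε ^ 2)) := by
  have h := ProbabilityTheory.hasSubgaussianMGF_of_mem_Icc (X := fun r : ℝ => r)
    measurable_id.aemeasurable hP
  -- Hoeffding at exponent `λ = 4 * ε` gives `λ ^ 2 / 8 - λ * ε = -2 * ε ^ 2`, the minimum over `λ`.
  have h1 := h.mgf_le (4 * ε * σ)
  have h2 := h.integrable_exp_mul (4 * ε * σ)
  have e : ∀ r : ℝ, Real.exp (4 * ε * (σ * (r - ∫ r, r ∂P) - ε)) =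
      Real.exp (4 * ε * σ * (r - ∫ r, r ∂P)) * Real.exp (-4 * ε ^ 2) := fun r => by
    rw [← Real.exp_add]; ring_nf
  simp only [e]
  rw [← ofReal_integral_eq_lintegral_ofReal (h2.mul_const _)
    (Filter.Eventually.of_forall fun r => by positivity)]
  refine ENNReal.ofReal_le_ofReal ?_
  rw [integral_mul_const]
  refine (mul_le_mul_of_nonneg_right h1 (Real.exp_pos _).le).trans ?_
  rw [← Real.exp_add, Real.exp_le_exp]
  push_cast
  simp only [sub_zero, norm_one]
  have e2 : (4 * ε * σ) ^ 2 = 16 * ε ^ 2 := by rw [mul_pow, hσ]; ring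
  rw [e2]
  linarith

/-- A user contributes the factor `exp (-2 * ε ^ 2)` only when the context is `k`. Averaging over a
uniform context therefore costs a factor of order `K` in the exponent, and no separate bound on the
random number of samples is needed. -/
theorem sum_inv_ite_le_exp {K : ℕ} (k : Fin K) {ε : ℝ} (h0 : 0 ≤ ε) (h1 : ε ≤ 1 / 2) :
    ∑ j : Fin K, (K : ℝ≥0∞)⁻¹ * (if j = k then ENNReal.ofReal (Real.exp (-2 * ε ^ 2)) else 1) ≤
      ENNReal.ofReal (Real.exp (-(ε ^ 2 / K))) := by
  have hK : 0 < K := k.pos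
  have hK' : (0 : ℝ) < K := by exact_mod_cast hK
  have e : ∀ j : Fin K, (K : ℝ≥0∞)⁻¹ *
      (if j = k then ENNReal.ofReal (Real.exp (-2 * ε ^ 2)) else 1) =
      ENNReal.ofReal ((K : ℝ)⁻¹ * (if j = k then Real.exp (-2 * ε ^ 2) else 1)) := fun j => by
    rw [ENNReal.ofReal_mul (by positivity), ENNReal.ofReal_inv_of_pos hK', ENNReal.ofReal_natCast]
    split_ifs <;> simp
  rw [Finset.sum_congr rfl fun j _ => e j, ← ENNReal.ofReal_sum_of_nonneg]
  swap
  · intro j _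
    positivity
  refine ENNReal.ofReal_le_ofReal ?_
  have e2 : ∀ j : Fin K, (K : ℝ)⁻¹ * (if j = k then Real.exp (-2 * ε ^ 2) else 1) =
      (K : ℝ)⁻¹ + (if j = k then (K : ℝ)⁻¹ * (Real.exp (-2 * ε ^ 2) - 1) else 0) := fun j => by
    split_ifs <;> ring
  rw [Finset.sum_congr rfl fun j _ => e2 j, Finset.sum_add_distrib]
  simp only [Finset.sum_const, Finset.card_univ, Fintype.card_fin, nsmul_eq_mul,
    Finset.sum_ite_eq', Finset.mem_univ, if_true]
  rw [mul_inv_cancel₀ hK'.ne']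
  -- From `exp (2 * ε ^ 2) ≥ 1 + 2 * ε ^ 2` and `(1 - ε ^ 2) * (1 + 2 * ε ^ 2) ≥ 1`, the latter
  -- because `ε ^ 2 ≤ 1 / 4`.
  have h3 : Real.exp (-2 * ε ^ 2) ≤ 1 - ε ^ 2 := by
    have h4 := Real.add_one_le_exp (2 * ε ^ 2)
    have h5 : Real.exp (-2 * ε ^ 2) * Real.exp (2 * ε ^ 2) = 1 := by
      rw [← Real.exp_add]; simp
    have h6 := Real.exp_pos (-2 * ε ^ 2)
    have h7 : ε ^ 2 ≤ 1 / 4 := by nlinarith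
    have h8 : Real.exp (-2 * ε ^ 2) * (1 + 2 * ε ^ 2) ≤ 1 := by nlinarith
    have h9 : 1 ≤ (1 - ε ^ 2) * (1 + 2 * ε ^ 2) := by nlinarith [sq_nonneg ε]
    by_contra hcon
    push Not at hcon
    nlinarith [sq_nonneg ε]
  calc 1 + (K : ℝ)⁻¹ * (Real.exp (-2 * ε ^ 2) - 1)
      ≤ 1 + (K : ℝ)⁻¹ * (-ε ^ 2) := by gcongr; linarith
    _ = -(ε ^ 2 / K) + 1 := by field_simp; ring
    _ ≤ _ := Real.add_one_le_exp _

theorem IsBalanced.card_message_ge {M N τ : ℕ} {g : Fin N → Fin τ} (hg : IsBalanced g)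
    (a : Fin τ → Fin M) (m : Fin M) :
    N / τ * (Finset.univ.filter fun s => a s = m).card ≤
      (Finset.univ.filter fun n => a (g n) = m).card := by
  have h : (Finset.univ.filter fun n => a (g n) = m).card =
      ∑ s ∈ Finset.univ.filter (fun s => a s = m), (Finset.univ.filter fun n => g n = s).card := by
    rw [Finset.card_eq_sum_card_fiberwise (f := g) (t := Finset.univ.filter fun s => a s = m)]
    · refine Finset.sum_congr rfl fun s hs => congrArg _ ?_
      ext n
      simp only [Finset.mem_filter, Finset.mem_univ, true_and] at hs ⊢
      exact ⟨fun h => h.2, fun h => ⟨h ▸ hs, h⟩⟩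
    · intro n hn
      simpa using hn
  rw [h, mul_comm, ← smul_eq_mul]
  refine Finset.card_nsmul_le_sum _ _ _ fun s _ => ?_
  rcases hg s with h | h <;> omega

/-! ### Concentration of the payoffs under a fixed schedule -/

namespace BroadcastBandit

variable {M N K τ : ℕ}

theorem lintegral_table_prod_ite (B : BroadcastBandit M N K τ) {φ : ℝ → ℝ≥0∞} (hφ : Measurable φ)
    (k : Fin K) (m : Fin M) (P : Fin N → Prop) [DecidablePred P] :
    ∫⁻ r, ∏ n, (if P n then φ (r n k m) else 1) ∂(Measure.pi fun _ : Fin N =>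
      Measure.pi fun k : Fin K => Measure.pi fun m : Fin M => B.payoff k m) =
      ∏ n, if P n then ∫⁻ r, φ r ∂(B.payoff k m) else 1 := by
  have := B.payoff_prob
  rw [lintegral_pi_prod (fun _ : Fin N => Measure.pi fun k : Fin K => Measure.pi fun m : Fin M =>
    B.payoff k m) (f := fun n (r : Fin K → Fin M → ℝ) => if P n then φ (r k m) else 1)]
  · refine Finset.prod_congr rfl fun n _ => ?_
    split_ifs with h
    · rw [(measurePreserving_eval (fun k : Fin K =>
        Measure.pi fun m : Fin M => B.payoff k m) k).lintegral_comp
        (f := fun r => φ (r m)) (by fun_prop)]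
      exact (measurePreserving_eval (fun m : Fin M => B.payoff k m) m).lintegral_comp hφ
    · simp
  · intro n
    split_ifs <;> fun_prop

theorem lintegral_arrivals_prod (B : BroadcastBandit M N K τ) (hB : B.UniformArrivals)
    (f : Fin N → Fin K → ℝ≥0∞) :
    ∫⁻ x, ∏ n, f n (x n) ∂B.arrivals.toMeasure = ∏ n, ∑ j, (K : ℝ≥0∞)⁻¹ * f n j := by
  rw [lintegral_fintype, Finset.prod_univ_sum, Fintype.piFinset_univ]
  refine Finset.sum_congr rfl fun x _ => ?_
  rw [PMF.toMeasure_apply_singleton _ _ (measurableSet_singleton _), hB x,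
    Finset.prod_mul_distrib, Finset.prod_const, Finset.card_univ, Fintype.card_fin,
    ENNReal.inv_pow, mul_comm]

theorem measurable_slot_ite {φ : ℝ → ℝ≥0∞} (hφ : Measurable φ) (a : Fin τ → Fin M) (k : Fin K)
    (m : Fin M) : Measurable fun z : Slot M N K τ =>
      ∏ n, (if z.1 n = k ∧ a (z.2.1 n) = m then φ (z.2.2 n k m) else 1) := by
  refine Finset.measurable_prod _ fun n _ => Measurable.ite ?_ ?_ measurable_const
  · have h : Measurable fun z : Slot M N K τ => (z.1, z.2.1) := by fun_prop
    exact h (Set.to_countable {p : (Fin N → Fin K) × (Fin N → Fin τ) |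
      p.1 n = k ∧ a (p.2 n) = m}).measurableSet
  · fun_prop

/-- The payoffs are integrated out at fixed contexts and division, and then the contexts at a fixed
division. The resulting bound uses only that the division is balanced, so the rule of division is
irrelevant. -/
theorem lintegral_slot_prod_le (B : BroadcastBandit M N K τ) (hB : B.UniformArrivals)
    {φ : ℝ → ℝ≥0∞} (hφ : Measurable φ) (a : Fin τ → Fin M) (k : Fin K) (m : Fin M) {ε : ℝ}
    (h0 : 0 ≤ ε) (h1 : ε ≤ 1 / 2)
    (hint : ∫⁻ r, φ r ∂(B.payoff k m) ≤ ENNReal.ofReal (Real.exp (-2 * ε ^ 2))) :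
    ∫⁻ z, ∏ n, (if z.1 n = k ∧ a (z.2.1 n) = m then φ (z.2.2 n k m) else 1) ∂B.slotLaw ≤
      ENNReal.ofReal (Real.exp (-(ε ^ 2 / K *
        ((N / τ : ℕ) * (Finset.univ.filter fun s => a s = m).card)))) := by
  have := B.payoff_prob
  set e := ENNReal.ofReal (Real.exp (-2 * ε ^ 2)) with he
  have hm := measurable_slot_ite (N := N) (K := K) hφ a k m
  unfold slotLaw
  rw [lintegral_prod _ hm.aemeasurable]
  calc _ = ∫⁻ x, ∫⁻ g, ∫⁻ r, ∏ n, (if x n = k ∧ a (g n) = m then φ (r n k m) else 1)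
          ∂(Measure.pi fun _ : Fin N => Measure.pi fun k : Fin K => Measure.pi fun m : Fin M =>
            B.payoff k m) ∂B.split.toMeasure ∂B.arrivals.toMeasure := by
        refine lintegral_congr fun x => ?_
        rw [lintegral_prod]
        exact (hm.comp measurable_prodMk_left).aemeasurable
    _ ≤ ∫⁻ x, ∫⁻ g, ∏ n, (if x n = k ∧ a (g n) = m then e else 1)
          ∂B.split.toMeasure ∂B.arrivals.toMeasure := by
        refine lintegral_mono fun x => lintegral_mono fun g => ?_
        rw [B.lintegral_table_prod_ite hφ]
        refine Finset.prod_le_prod' fun n _ => ?_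
        split_ifs
        · exact hint
        · exact le_rfl
    _ = ∫⁻ g, ∫⁻ x, ∏ n, (if x n = k ∧ a (g n) = m then e else 1)
          ∂B.arrivals.toMeasure ∂B.split.toMeasure :=
        lintegral_lintegral_swap (measurable_of_finite _).aemeasurable
    _ ≤ ∫⁻ g, ENNReal.ofReal (Real.exp (-(ε ^ 2 / K *
        ((N / τ : ℕ) * (Finset.univ.filter fun s => a s = m).card)))) ∂B.split.toMeasure := by
        refine lintegral_mono_ae ?_
        filter_upwards [B.split.ae_mem_support] with g hg
        rw [B.lintegral_arrivals_prod hB fun n j => if j = k ∧ a (g n) = m then e else 1]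
        have hfac : ∀ n, ∑ j : Fin K, (K : ℝ≥0∞)⁻¹ * (if j = k ∧ a (g n) = m then e else 1) ≤
            ENNReal.ofReal (Real.exp (-(ε ^ 2 / K * if a (g n) = m then 1 else 0))) := by
          intro n
          by_cases hn : a (g n) = m
          · simpa only [hn, and_true, if_true, mul_one] using sum_inv_ite_le_exp k h0 h1
          · have hK : (K : ℝ≥0∞) ≠ 0 := by exact_mod_cast k.pos.ne'
            simp [hn, ENNReal.mul_inv_cancel hK (ENNReal.natCast_ne_top K)]
        refine (Finset.prod_le_prod' fun n _ => hfac n).trans ?_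
        rw [← ENNReal.ofReal_prod_of_nonneg fun n _ => (Real.exp_pos _).le, ← Real.exp_sum]
        refine ENNReal.ofReal_le_ofReal (Real.exp_le_exp.2 ?_)
        rw [Finset.sum_neg_distrib, neg_le_neg_iff, ← Finset.mul_sum, Finset.sum_boole]
        refine mul_le_mul_of_nonneg_left ?_ (by positivity)
        exact_mod_cast (B.split_balanced g hg).card_message_ge a m
    _ = _ := by simp

instance (B : BroadcastBandit M N K τ) : IsProbabilityMeasure B.law := by
  unfold law; infer_instance

theorem measurePreserving_eval_law (B : BroadcastBandit M N K τ) (t : ℕ) :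
    MeasurePreserving (fun ω : ℕ → Slot M N K τ => ω t) B.law B.slotLaw :=
  measurePreserving_eval_infinitePi (fun _ : ℕ => B.slotLaw) t

theorem lintegral_law_prod (B : BroadcastBandit M N K τ) (L : ℕ) {f : ℕ → Slot M N K τ → ℝ≥0∞}
    (hf : ∀ t, Measurable (f t)) :
    ∫⁻ ω, ∏ t ∈ Finset.range L, f t (ω t) ∂B.law =
      ∏ t ∈ Finset.range L, ∫⁻ z, f t z ∂B.slotLaw := by
  unfold law
  rw [ProbabilityTheory.lintegral_prod_eq_prod_lintegral_of_indepFun (Finset.range L)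
    (fun t (ω : ℕ → Slot M N K τ) => f t (ω t)) (ProbabilityTheory.iIndepFun_infinitePi hf)
    fun t => (hf t).comp (measurable_pi_apply t)]
  exact Finset.prod_congr rfl fun t _ => (B.measurePreserving_eval_law t).lintegral_comp (hf t)

/-- The deviation, in direction `σ` and beyond `ε`, of the payoffs that users with context `k` give
to message `m` in the first `L` timeslots when the messages follow the fixed schedule `a`. -/
noncomputable def scheduleDeviation (B : BroadcastBandit M N K τ) (a : ℕ → Fin τ → Fin M) (L : ℕ)
    (k : Fin K) (m : Fin M) (ε σ : ℝ) (ω : ℕ → Slot M N K τ) : ℝ :=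
  ∑ t ∈ Finset.range L, ∑ n,
    if (ω t).1 n = k ∧ a t ((ω t).2.1 n) = m then
      σ * ((ω t).2.2 n k m - B.mean k m) - ε else 0

/-- Markov's inequality for the exponential of `4 * ε` times the deviation, which factors over the
independent timeslots. Since `ε` is subtracted once per sample, having too few samples is covered by
the same bound: with no sample the deviation is `0` and counts as a failure. -/
theorem measure_scheduleDeviation_nonneg_le (B : BroadcastBandit M N K τ) (hB : B.UniformArrivals)
    (a : ℕ → Fin τ → Fin M) {L q : ℕ} (k : Fin K) (m : Fin M)
    (hq : q ≤ ∑ t ∈ Finset.range L, (Finset.univ.filter fun s => a t s = m).card) {ε σ : ℝ}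
    (h0 : 0 ≤ ε) (h1 : ε ≤ 1 / 2) (hσ : σ ^ 2 = 1) :
    B.law {ω | 0 ≤ B.scheduleDeviation a L k m ε σ ω} ≤
      ENNReal.ofReal (Real.exp (-(ε ^ 2 / K * ((N / τ : ℕ) * q)))) := by
  have := B.payoff_prob
  set φ : ℝ → ℝ≥0∞ := fun r =>
    ENNReal.ofReal (Real.exp (4 * ε * (σ * (r - B.mean k m) - ε))) with hφdef
  have hφ : Measurable φ := by fun_prop
  have hint := lintegral_exp_deviation_le (B.payoff k m) (B.payoff_mem k m) ε σ hσ
  set F : ℕ → Slot M N K τ → ℝ≥0∞ := fun t z =>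
    ∏ n, (if z.1 n = k ∧ a t (z.2.1 n) = m then φ (z.2.2 n k m) else 1) with hF
  have hFm : ∀ t, Measurable (F t) := fun t => measurable_slot_ite hφ (a t) k m
  have hexp : ∀ ω, ENNReal.ofReal (Real.exp (4 * ε * B.scheduleDeviation a L k m ε σ ω)) =
      ∏ t ∈ Finset.range L, F t (ω t) := by
    intro ω
    rw [scheduleDeviation, Finset.mul_sum, Real.exp_sum,
      ENNReal.ofReal_prod_of_nonneg fun t _ => (Real.exp_pos _).le]
    refine Finset.prod_congr rfl fun t _ => ?_
    rw [Finset.mul_sum, Real.exp_sum, ENNReal.ofReal_prod_of_nonneg fun t _ => (Real.exp_pos _).le]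
    refine Finset.prod_congr rfl fun n _ => ?_
    split_ifs <;> simp [hφdef]
  have hmeas : Measurable fun ω : ℕ → Slot M N K τ => ∏ t ∈ Finset.range L, F t (ω t) :=
    Finset.measurable_prod _ fun t _ => (hFm t).comp (measurable_pi_apply t)
  calc B.law {ω | 0 ≤ B.scheduleDeviation a L k m ε σ ω}
      ≤ B.law {ω | 1 ≤ ∏ t ∈ Finset.range L, F t (ω t)} := by
        refine measure_mono fun ω hω => ?_
        simp only [Set.mem_ofPred_eq] at hω ⊢
        rw [← hexp ω, ENNReal.one_le_ofReal, Real.one_le_exp_iff]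
        positivity
    _ ≤ ∫⁻ ω, ∏ t ∈ Finset.range L, F t (ω t) ∂B.law := by
        simpa using mul_meas_ge_le_lintegral (μ := B.law) hmeas 1
    _ = ∏ t ∈ Finset.range L, ∫⁻ z, F t z ∂B.slotLaw := B.lintegral_law_prod L hFm
    _ ≤ ∏ t ∈ Finset.range L, ENNReal.ofReal (Real.exp (-(ε ^ 2 / K *
        ((N / τ : ℕ) * (Finset.univ.filter fun s => a t s = m).card)))) :=
        Finset.prod_le_prod' fun t _ => B.lintegral_slot_prod_le hB hφ (a t) k m h0 h1 hint
    _ ≤ _ := by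
        rw [← ENNReal.ofReal_prod_of_nonneg fun n _ => (Real.exp_pos _).le, ← Real.exp_sum]
        refine ENNReal.ofReal_le_ofReal (Real.exp_le_exp.2 ?_)
        rw [Finset.sum_neg_distrib, neg_le_neg_iff, ← Finset.mul_sum, ← Finset.mul_sum]
        gcongr
        exact_mod_cast hq

end BroadcastBandit

/-! ### The explore-then-commit strategy and its statistics -/

namespace Strategy

variable {M N K τ : ℕ}

theorem history_apply (π : Strategy M N K τ) (ω : ℕ → Slot M N K τ) (t : ℕ) (i : Fin t) :
    π.history ω t i = observe (ω i) (π.message ω i) := by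
  induction t with
  | zero => exact i.elim0
  | succ t ih =>
    refine Fin.lastCases ?_ (fun i => ?_) i
    · simp only [history, Fin.snoc_last, Fin.val_last]
      rfl
    · simp only [history, Fin.snoc_castSucc, Fin.val_castSucc]
      exact ih i

theorem history_congr (π : Strategy M N K τ) {ω ω' : ℕ → Slot M N K τ} {t : ℕ}
    (h : ∀ i < t, ω i = ω' i) : π.history ω t = π.history ω' t := by
  induction t with
  | zero => rfl
  | succ t ih =>
    simp only [history]
    rw [ih fun i hi => h i (by omega), h t (by omega)]

/-- The number of payoffs that users with context `k` gave to message `m` in the first `L`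
timeslots. -/
noncomputable def count (L : ℕ) {t : ℕ} (h : Fin t → Observation M N K τ) (k : Fin K)
    (m : Fin M) : ℝ :=
  ∑ i : Fin t, if (i : ℕ) < L then
    ∑ n, if (h i).1 n = k ∧ (h i).2.2.1 ((h i).2.1 n) = m then 1 else 0 else 0

/-- The sum of the payoffs that users with context `k` gave to message `m` in the first `L`
timeslots. -/
noncomputable def total (L : ℕ) {t : ℕ} (h : Fin t → Observation M N K τ) (k : Fin K)
    (m : Fin M) : ℝ :=
  ∑ i : Fin t, if (i : ℕ) < L then
    ∑ n, if (h i).1 n = k ∧ (h i).2.2.1 ((h i).2.1 n) = m then (h i).2.2.2 n else 0 else 0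

theorem measurableSet_hit {t : ℕ} (i : Fin t) (n : Fin N) (k : Fin K) (m : Fin M) :
    MeasurableSet {h : Fin t → Observation M N K τ |
      (h i).1 n = k ∧ (h i).2.2.1 ((h i).2.1 n) = m} := by
  have e : Measurable fun h : Fin t → Observation M N K τ =>
      ((h i).1, (h i).2.1, (h i).2.2.1) := by fun_prop
  exact e (Set.to_countable {p : (Fin N → Fin K) × (Fin N → Fin τ) × (Fin τ → Fin M) |
    p.1 n = k ∧ p.2.2 (p.2.1 n) = m}).measurableSet

theorem measurable_count (L t : ℕ) (k : Fin K) (m : Fin M) :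
    Measurable fun h : Fin t → Observation M N K τ => count L h k m := by
  refine Finset.measurable_sum _ fun i _ => ?_
  split_ifs
  · exact Finset.measurable_sum _ fun n _ =>
      Measurable.ite (measurableSet_hit i n k m) measurable_const measurable_const
  · exact measurable_const

theorem measurable_total (L t : ℕ) (k : Fin K) (m : Fin M) :
    Measurable fun h : Fin t → Observation M N K τ => total L h k m := by
  refine Finset.measurable_sum _ fun i _ => ?_
  split_ifs
  · exact Finset.measurable_sum _ fun n _ =>
      Measurable.ite (measurableSet_hit i n k m) (by fun_prop) measurable_const
  · exact measurable_const

/-- The estimated total payoff of subgroup `s` for message `m`, from the empirical means of the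
first `L` timeslots. -/
noncomputable def score (L : ℕ) {t : ℕ} (h : Fin t → Observation M N K τ) (x : Fin N → Fin K)
    (g : Fin N → Fin τ) (s : Fin τ) (m : Fin M) : ℝ :=
  ∑ n ∈ Finset.univ.filter (fun n => g n = s), total L h (x n) m / count L h (x n) m

open scoped Classical in
/-- An element that dominates all others in the relation `R`, or `d` if there is none. -/
noncomputable def pickMax (d : Fin M) (R : Fin M → Fin M → Prop) : Fin M :=
  if h : ∃ m, ∀ m', R m' m then h.choose else d

theorem le_pickMax (d : Fin M) (f : Fin M → ℝ) (m : Fin M) :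
    f m ≤ f (pickMax d fun m₁ m₂ => f m₁ ≤ f m₂) := by
  have : Nonempty (Fin M) := ⟨d⟩
  have h : ∃ m, ∀ m', f m' ≤ f m := Finite.exists_max f
  unfold pickMax
  rw [dif_pos h]
  exact h.choose_spec m

/-- Explore then commit: follow the schedule `a` for `L` timeslots, and then serve every subgroup
the message with the largest score. -/
noncomputable def exploreCommit (a : ℕ → Fin τ → Fin M) (L : ℕ) (d : Fin M) :
    Strategy M N K τ where
  choose t h x g s :=
    if t < L then a t s else pickMax d fun m₁ m₂ => score L h x g s m₁ ≤ score L h x g s m₂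
  measurable_choose t := by
    refine measurable_from_prod_countable_left fun q => ?_
    rw [measurable_pi_iff]
    intro s
    split_ifs
    · exact measurable_const
    · have hscore : ∀ m, Measurable fun h : Fin t → Observation M N K τ =>
          score L h q.1 q.2 s m := fun m => Finset.measurable_sum _ fun n _ =>
        (measurable_total L t (q.1 n) m).div (measurable_count L t (q.1 n) m)
      -- The choice sees the scores only through their comparison relation, and the relations on
      -- `Fin M` form a finite type.
      refine (measurable_of_finite (pickMax d)).comp ?_
      refine measurable_pi_iff.2 fun m₁ => measurable_pi_iff.2 fun m₂ => ?_
      exact measurableSet_setOfPred.1 (measurableSet_le (hscore m₁) (hscore m₂))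

theorem exploreCommit_message_of_lt (a : ℕ → Fin τ → Fin M) {L : ℕ} (d : Fin M)
    (ω : ℕ → Slot M N K τ) {i : ℕ} (hi : i < L) :
    (exploreCommit a L d : Strategy M N K τ).message ω i = a i := by
  funext s
  simp [message, exploreCommit, hi]

theorem sum_fin_ite_lt {L t : ℕ} (h : L ≤ t) (f : ℕ → ℝ) :
    ∑ i : Fin t, (if (i : ℕ) < L then f i else 0) = ∑ i ∈ Finset.range L, f i := by
  rw [Fin.sum_univ_eq_sum_range (fun i => if i < L then f i else 0), ← Finset.sum_filter]
  refine Finset.sum_congr ?_ fun _ _ => rfl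
  ext i
  simp only [Finset.mem_filter, Finset.mem_range]
  omega

/-- Exploration ignores the observations, so the statistics of the strategy are those of a fixed
schedule, to which the Chernoff bound applies. -/
theorem scheduleDeviation_eq (B : BroadcastBandit M N K τ) (a : ℕ → Fin τ → Fin M) {L t : ℕ}
    (hLt : L ≤ t) (d : Fin M) (k : Fin K) (m : Fin M) (ε σ : ℝ) (ω : ℕ → Slot M N K τ) :
    B.scheduleDeviation a L k m ε σ ω =
      σ * (total L ((exploreCommit a L d).history ω t) k m -
        B.mean k m * count L ((exploreCommit a L d).history ω t) k m) -
      ε * count L ((exploreCommit a L d).history ω t) k m := by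
  have hc : count L ((exploreCommit a L d).history ω t) k m = ∑ i ∈ Finset.range L, ∑ n,
      if (ω i).1 n = k ∧ a i ((ω i).2.1 n) = m then 1 else 0 := by
    rw [← sum_fin_ite_lt hLt]
    refine Finset.sum_congr rfl fun i _ => ?_
    split_ifs with hi
    · rw [history_apply, exploreCommit_message_of_lt a d ω hi]
      rfl
    · rfl
  have ht : total L ((exploreCommit a L d).history ω t) k m = ∑ i ∈ Finset.range L, ∑ n,
      if (ω i).1 n = k ∧ a i ((ω i).2.1 n) = m then (ω i).2.2 n k m else 0 := by
    rw [← sum_fin_ite_lt hLt]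
    refine Finset.sum_congr rfl fun i _ => ?_
    split_ifs with hi
    · rw [history_apply, exploreCommit_message_of_lt a d ω hi]
      refine Finset.sum_congr rfl fun n _ => ?_
      change (if (ω i).1 n = k ∧ a i ((ω i).2.1 n) = m then
        (ω i).2.2 n ((ω i).1 n) (a i ((ω i).2.1 n)) else 0) = _
      by_cases hn : (ω i).1 n = k ∧ a i ((ω i).2.1 n) = m
      · rw [if_pos hn, if_pos hn, hn.1, hn.2]
      · rw [if_neg hn, if_neg hn]
    · rfl
  rw [hc, ht, BroadcastBandit.scheduleDeviation]
  simp only [Finset.mul_sum, ← Finset.sum_sub_distrib]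
  refine Finset.sum_congr rfl fun i _ => Finset.sum_congr rfl fun n _ => ?_
  split_ifs <;> ring

end Strategy

/-! ### Independence of past and present; expected loss in one timeslot -/

namespace BroadcastBandit

open Strategy

variable {M N K τ : ℕ}

theorem indepFun_history (B : BroadcastBandit M N K τ) (π : Strategy M N K τ) (t : ℕ) :
    ProbabilityTheory.IndepFun (fun ω => π.history ω t) (fun ω => ω t) B.law := by
  have h := (ProbabilityTheory.iIndepFun_infinitePi (P := fun _ : ℕ => B.slotLaw)
    (X := fun _ z => z) (fun _ => measurable_id)).indepFun_finset (Finset.range t) {t}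
    (by simp) (fun i => measurable_pi_apply i)
  -- Padding the first `t` timeslots with the dummy `z₀` displays the history as a function of those
  -- timeslots alone.
  obtain ⟨z₀⟩ : Nonempty (Slot M N K τ) := nonempty_of_isProbabilityMeasure B.slotLaw
  let ext : (Finset.range t → Slot M N K τ) → ℕ → Slot M N K τ :=
    fun v i => if hi : i ∈ Finset.range t then v ⟨i, hi⟩ else z₀
  have hext : Measurable ext := by
    refine measurable_pi_iff.2 fun i => ?_
    by_cases hi : i ∈ Finset.range t
    · have e : (fun v => ext v i) = fun v => v ⟨i, hi⟩ := funext fun v => dif_pos hi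
      rw [e]
      exact measurable_pi_apply _
    · have e : (fun v => ext v i) = fun _ => z₀ := funext fun v => dif_neg hi
      rw [e]
      exact measurable_const
  have hlast : Measurable fun v : ({t} : Finset ℕ) → Slot M N K τ => v ⟨t, by simp⟩ :=
    measurable_pi_apply _
  have h2 := h.comp ((π.measurable_history t).comp hext) hlast
  have e : (fun ω => π.history ω t) =
      ((fun ω => π.history ω t) ∘ ext) ∘ fun (ω : ℕ → Slot M N K τ) (i : Finset.range t) => ω i :=
    funext fun ω => π.history_congr fun i hi => by simp [ext, hi]
  rw [e]
  exact h2

theorem map_history_eval (B : BroadcastBandit M N K τ) (π : Strategy M N K τ) (t : ℕ) :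
    B.law.map (fun ω => (π.history ω t, ω t)) =
      (B.law.map fun ω => π.history ω t).prod B.slotLaw := by
  rw [(ProbabilityTheory.indepFun_iff_map_prod_eq_prod_map_map
    (π.measurable_history t).aemeasurable (measurable_pi_apply t).aemeasurable).1
    (B.indepFun_history π t), (B.measurePreserving_eval_law t).map_eq]

theorem mean_mem (B : BroadcastBandit M N K τ) (k : Fin K) (m : Fin M) :
    B.mean k m ∈ Set.Icc (0 : ℝ) 1 := by
  have := B.payoff_prob k m
  refine ⟨integral_nonneg_of_ae ?_, ?_⟩
  · filter_upwards [B.payoff_mem k m] with r hr using hr.1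
  · have h : ∫ r, r ∂(B.payoff k m) ≤ ∫ _, 1 ∂(B.payoff k m) := by
      refine integral_mono_ae (Integrable.of_mem_Icc 0 1 measurable_id.aemeasurable
        (B.payoff_mem k m)) (integrable_const _) ?_
      filter_upwards [B.payoff_mem k m] with r hr using hr.2
    simpa [mean] using h

theorem best_le (B : BroadcastBandit M N K τ) (d : Fin M) (x : Fin N → Fin K)
    (g : Fin N → Fin τ) : B.best x g ≤ N := by
  have : Nonempty (Fin M) := ⟨d⟩
  have h : B.best x g ≤ ∑ s : Fin τ, ((Finset.univ.filter fun n => g n = s).card : ℝ) := by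
    refine Finset.sum_le_sum fun s _ => ciSup_le fun m => ?_
    refine (Finset.sum_le_card_nsmul _ _ 1 fun n _ => (B.mean_mem _ _).2).trans ?_
    simp
  refine h.trans ?_
  rw [← Nat.cast_sum, ← Finset.card_eq_sum_card_fiberwise (f := g) (by simp)]
  simp

/-- The loss in timeslot `t`. -/
noncomputable def slotLoss (B : BroadcastBandit M N K τ) (z : Slot M N K τ)
    (c : Fin τ → Fin M) : ℝ :=
  B.best z.1 z.2.1 - ∑ n : Fin N, z.2.2 n (z.1 n) (c (z.2.1 n))

theorem integrable_slotLoss (B : BroadcastBandit M N K τ) (π : Strategy M N K τ) (t : ℕ) :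
    Integrable (fun ω => B.slotLoss (ω t) (π.message ω t)) B.law := by
  refine ((B.integrable_pathRegret π (t + 1)).sub (B.integrable_pathRegret π t)).congr ?_
  refine Filter.Eventually.of_forall fun ω => ?_
  simp only [pathRegret, Pi.sub_apply, Finset.sum_range_succ, slotLoss, add_sub_cancel_left]

theorem regret_eq_sum (B : BroadcastBandit M N K τ) (π : Strategy M N K τ) (T : ℕ) :
    B.regret π T = ∑ t ∈ Finset.range T, ∫ ω, B.slotLoss (ω t) (π.message ω t) ∂B.law :=
  integral_finsetSum _ fun t _ => B.integrable_slotLoss π t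

theorem integral_slotLoss_le (B : BroadcastBandit M N K τ) (d : Fin M) (π : Strategy M N K τ)
    (t : ℕ) : ∫ ω, B.slotLoss (ω t) (π.message ω t) ∂B.law ≤ N := by
  have h : ∫ ω, B.slotLoss (ω t) (π.message ω t) ∂B.law ≤ ∫ _, (N : ℝ) ∂B.law := by
    refine integral_mono_ae (B.integrable_slotLoss π t) (integrable_const _) ?_
    filter_upwards [B.ae_payoff_mem t] with ω hω
    have h1 := B.best_le d (ω t).1 (ω t).2.1
    have h2 : 0 ≤ ∑ n : Fin N, (ω t).2.2 n ((ω t).1 n) (π.message ω t ((ω t).2.1 n)) :=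
      Finset.sum_nonneg fun n _ => (hω _ _ _).1
    unfold slotLoss
    linarith
  simpa using h

theorem ae_slotLaw_payoff_mem (B : BroadcastBandit M N K τ) :
    ∀ᵐ z ∂B.slotLaw, ∀ n k m, z.2.2 n k m ∈ Set.Icc (0 : ℝ) 1 := by
  rw [← (B.measurePreserving_eval_law 0).map_eq, ae_map_iff (B.measurePreserving_eval_law 0).aemeasurable]
  · exact B.ae_payoff_mem 0
  · simp only [measurableSet_setOfPred]
    refine Measurable.forall fun n => Measurable.forall fun k => Measurable.forall fun m => ?_
    exact measurableSet_setOfPred.1 ((by fun_prop : Measurable fun z : Slot M N K τ =>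
      z.2.2 n k m) measurableSet_Icc)

theorem ae_slotLaw_balanced (B : BroadcastBandit M N K τ) :
    ∀ᵐ z ∂B.slotLaw, IsBalanced z.2.1 := by
  have := B.payoff_prob
  have h : Measure.QuasiMeasurePreserving (fun z : Slot M N K τ => z.2.1) B.slotLaw
      B.split.toMeasure :=
    Measure.quasiMeasurePreserving_fst.comp Measure.quasiMeasurePreserving_snd
  filter_upwards [h.ae B.split.ae_mem_support] with z hz using B.split_balanced _ hz

theorem integrable_slot_payoff (B : BroadcastBandit M N K τ)
    (c : (Fin N → Fin K) → (Fin N → Fin τ) → Fin τ → Fin M) (n : Fin N) :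
    Integrable (fun z : Slot M N K τ => z.2.2 n (z.1 n) (c z.1 z.2.1 (z.2.1 n))) B.slotLaw := by
  have hc : Measurable fun p : (Fin N → Fin K) × (Fin N → Fin τ) => c p.1 p.2 :=
    measurable_of_finite _
  have hm : Measurable fun z : Slot M N K τ => z.2.2 n (z.1 n) (c z.1 z.2.1 (z.2.1 n)) := by
    have h2 : Measurable fun z : Slot M N K τ => Strategy.observe z (c z.1 z.2.1) :=
      Strategy.measurable_observe.comp (measurable_id.prodMk
        (hc.comp (by fun_prop : Measurable fun z : Slot M N K τ => (z.1, z.2.1))))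
    exact (measurable_pi_apply n).comp h2.snd.snd.snd
  refine Integrable.of_bound hm.aestronglyMeasurable 1 ?_
  filter_upwards [B.ae_slotLaw_payoff_mem] with z hz
  obtain ⟨h0, h1⟩ := hz n (z.1 n) (c z.1 z.2.1 (z.2.1 n))
  rw [Real.norm_eq_abs, abs_of_nonneg h0]
  exact h1

theorem integrable_slot_of_finite (B : BroadcastBandit M N K τ)
    (f : (Fin N → Fin K) → (Fin N → Fin τ) → ℝ) :
    Integrable (fun z : Slot M N K τ => f z.1 z.2.1) B.slotLaw := by
  have hm : Measurable fun z : Slot M N K τ => (z.1, z.2.1) := by fun_prop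
  have : IsProbabilityMeasure (B.slotLaw.map fun z => (z.1, z.2.1)) :=
    Measure.isProbabilityMeasure_map hm.aemeasurable
  have hi : Integrable (fun p : (Fin N → Fin K) × (Fin N → Fin τ) => f p.1 p.2)
      (B.slotLaw.map fun z => (z.1, z.2.1)) := Integrable.of_finite
  exact hi.comp_measurable hm

/-- The message depends only on contexts and division, which are independent of the payoff table;
with these fixed, a single table entry is integrated. -/
theorem integral_slot_payoff (B : BroadcastBandit M N K τ)
    (c : (Fin N → Fin K) → (Fin N → Fin τ) → Fin τ → Fin M) (n : Fin N) :
    ∫ z : Slot M N K τ, z.2.2 n (z.1 n) (c z.1 z.2.1 (z.2.1 n)) ∂B.slotLaw =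
      ∫ z : Slot M N K τ, B.mean (z.1 n) (c z.1 z.2.1 (z.2.1 n)) ∂B.slotLaw := by
  have := B.payoff_prob
  have h1 := B.integrable_slot_payoff c n
  have h2 := B.integrable_slot_of_finite fun x g => B.mean (x n) (c x g (g n))
  unfold slotLaw at h1 h2 ⊢
  rw [integral_prod _ h1, integral_prod _ h2]
  refine integral_congr_ae ?_
  filter_upwards [h1.prod_right_ae, h2.prod_right_ae] with x hx1 hx2
  rw [integral_prod _ hx1, integral_prod _ hx2]
  refine integral_congr_ae (Filter.Eventually.of_forall fun g => ?_)
  have hmp := (measurePreserving_eval (fun m : Fin M => B.payoff (x n) m) (c x g (g n))).comp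
    ((measurePreserving_eval (fun k : Fin K => Measure.pi fun m : Fin M => B.payoff k m)
      (x n)).comp (measurePreserving_eval (fun _ : Fin N => Measure.pi fun k : Fin K =>
        Measure.pi fun m : Fin M => B.payoff k m) n))
  have h3 := integral_map (μ := Measure.pi fun _ : Fin N => Measure.pi fun k : Fin K =>
    Measure.pi fun m : Fin M => B.payoff k m) hmp.measurable.aemeasurable
    (f := fun r : ℝ => r) measurable_id.aestronglyMeasurable
  rw [hmp.map_eq] at h3
  simp only [integral_const, probReal_univ, one_smul]
  exact h3.symm

theorem integral_slot_context (B : BroadcastBandit M N K τ) (hB : B.UniformArrivals)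
    (w : Fin K → ℝ) (n : Fin N) :
    ∫ z : Slot M N K τ, w (z.1 n) ∂B.slotLaw = ∑ k, (K : ℝ)⁻¹ * w k := by
  have := B.payoff_prob
  have h1 : ∫ z : Slot M N K τ, w (z.1 n) ∂B.slotLaw =
      ∫ x, w (x n) ∂B.arrivals.toMeasure := by
    unfold slotLaw
    rw [integral_fun_fst (fun x : Fin N → Fin K => w (x n))]
    simp
  rw [h1, PMF.integral_eq_sum]
  -- The sum over context vectors factors over the users; every factor except that of user `n`
  -- equals `1`.
  have h2 := Finset.prod_univ_sum (fun _ : Fin N => (Finset.univ : Finset (Fin K)))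
    fun i j => (K : ℝ)⁻¹ * (if i = n then w j else 1)
  have hK : (K : ℝ) ≠ 0 ∨ K = 0 := by
    rcases Nat.eq_zero_or_pos K with h | h
    · exact Or.inr h
    · exact Or.inl (by exact_mod_cast h.ne')
  rcases hK with hK | rfl
  swap
  · have : IsEmpty (Fin N → Fin 0) := ⟨fun x => (x n).elim0⟩
    simp
  rw [Fintype.piFinset_univ] at h2
  have e1 : ∏ i : Fin N, ∑ j : Fin K, (K : ℝ)⁻¹ * (if i = n then w j else 1) =
      ∑ k, (K : ℝ)⁻¹ * w k := by
    rw [Finset.prod_eq_single n]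
    · simp
    · intro i _ hi
      simp [hi, hK]
    · simp
  rw [← e1, h2]
  refine Finset.sum_congr rfl fun x _ => ?_
  rw [hB x, Finset.prod_mul_distrib, Finset.prod_const, Finset.card_univ, Fintype.card_fin,
    Finset.prod_ite_eq' Finset.univ n fun i => w (x i)]
  simp

theorem integral_slotLoss_eq (B : BroadcastBandit M N K τ)
    (c : (Fin N → Fin K) → (Fin N → Fin τ) → Fin τ → Fin M) :
    ∫ z : Slot M N K τ, B.slotLoss z (c z.1 z.2.1) ∂B.slotLaw =
      ∫ z : Slot M N K τ, (B.best z.1 z.2.1 - ∑ n, B.mean (z.1 n) (c z.1 z.2.1 (z.2.1 n)))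
        ∂B.slotLaw := by
  unfold slotLoss
  rw [integral_sub (B.integrable_slot_of_finite B.best)
      (integrable_finsetSum _ fun n _ => B.integrable_slot_payoff c n),
    integral_sub (B.integrable_slot_of_finite B.best)
      (integrable_finsetSum _ fun n _ => B.integrable_slot_of_finite fun x g =>
        B.mean (x n) (c x g (g n))),
    integral_finsetSum _ fun n _ => B.integrable_slot_payoff c n,
    integral_finsetSum _ fun n _ => B.integrable_slot_of_finite fun x g =>
        B.mean (x n) (c x g (g n))]
  simp only [B.integral_slot_payoff c]

end BroadcastBandit

/-! ### Accurate estimates and the loss during exploitation -/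

namespace BroadcastBandit

open Strategy

variable {M N K τ : ℕ}

/-- The first `L` timeslots estimate the mean payoff of message `m` in context `k` up to an error
less than `ε`. -/
def Accurate (B : BroadcastBandit M N K τ) (L : ℕ) (ε : ℝ) {t : ℕ}
    (h : Fin t → Observation M N K τ) (k : Fin K) (m : Fin M) : Prop :=
  |total L h k m - B.mean k m * count L h k m| < ε * count L h k m

theorem Accurate.abs_sub_lt {B : BroadcastBandit M N K τ} {L : ℕ} {ε : ℝ} {t : ℕ}
    {h : Fin t → Observation M N K τ} {k : Fin K} {m : Fin M} (hε : 0 ≤ ε)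
    (H : B.Accurate L ε h k m) :
    |total L h k m / count L h k m - B.mean k m| < ε := by
  -- The strict inequality in `Accurate` excludes an empty sample, so the quotient is a genuine
  -- mean.
  have hc : 0 < count L h k m := by
    have h1 := (abs_nonneg _).trans_lt H
    by_contra hc
    have h2 := mul_nonpos_of_nonneg_of_nonpos hε (not_lt.1 hc)
    linarith
  have e : total L h k m / count L h k m - B.mean k m =
      (total L h k m - B.mean k m * count L h k m) / count L h k m := by
    field_simp
  rw [e, abs_div, abs_of_pos hc, div_lt_iff₀ hc]
  exact H

theorem measurableSet_not_accurate (B : BroadcastBandit M N K τ) (L t : ℕ) (ε : ℝ) (k : Fin K)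
    (m : Fin M) :
    MeasurableSet {h : Fin t → Observation M N K τ | ¬ B.Accurate L ε h k m} := by
  have h : MeasurableSet {h : Fin t → Observation M N K τ | B.Accurate L ε h k m} :=
    measurableSet_lt
      (continuous_abs.measurable.comp
        ((measurable_total L t k m).sub ((measurable_count L t k m).const_mul _)))
      ((measurable_count L t k m).const_mul _)
  exact h.compl

theorem measure_not_accurate_le (B : BroadcastBandit M N K τ) (hB : B.UniformArrivals)
    (a : ℕ → Fin τ → Fin M) {L q t : ℕ} (hLt : L ≤ t) (d : Fin M) (k : Fin K) (m : Fin M)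
    (hq : q ≤ ∑ t ∈ Finset.range L, (Finset.univ.filter fun s => a t s = m).card) {ε : ℝ}
    (h0 : 0 ≤ ε) (h1 : ε ≤ 1 / 2) :
    B.law.real {ω | ¬ B.Accurate L ε ((exploreCommit a L d).history ω t) k m} ≤
      2 * Real.exp (-(ε ^ 2 / K * ((N / τ : ℕ) * q))) := by
  set E := Real.exp (-(ε ^ 2 / K * ((N / τ : ℕ) * q))) with hE
  -- The two signs `σ = 1` and `σ = -1` account for over- and underestimation.
  have hsub : {ω | ¬ B.Accurate L ε ((exploreCommit a L d).history ω t) k m} ⊆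
      {ω | 0 ≤ B.scheduleDeviation a L k m ε 1 ω} ∪
      {ω | 0 ≤ B.scheduleDeviation a L k m ε (-1) ω} := by
    intro ω hω
    simp only [Set.mem_union, Set.mem_ofPred_eq, scheduleDeviation_eq B a hLt d, Accurate, not_lt,
      le_abs] at hω ⊢
    rcases hω with hω | hω
    · left; linarith
    · right; linarith
  have h2 : B.law {ω | ¬ B.Accurate L ε ((exploreCommit a L d).history ω t) k m} ≤
      ENNReal.ofReal (2 * E) := by
    refine (measure_mono hsub).trans ((measure_union_le _ _).trans ?_)
    rw [two_mul, ENNReal.ofReal_add (Real.exp_pos _).le (Real.exp_pos _).le]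
    exact add_le_add
      (B.measure_scheduleDeviation_nonneg_le hB a k m hq h0 h1 (by norm_num))
      (B.measure_scheduleDeviation_nonneg_le hB a k m hq h0 h1 (by norm_num))
  exact ENNReal.toReal_le_of_le_ofReal (by positivity) h2

/-- Both sums are integer multiples of the same `Δ ≥ δ`, so one cannot exceed the other by a
positive amount below `δ`. -/
theorem DiscretePayoffs.sum_le_of_sum_lt_add {B : BroadcastBandit M N K τ} {δ : ℝ} (hδ : 0 < δ)
    (hD : B.DiscretePayoffs δ) (S : Finset (Fin N)) (x : Fin N → Fin K) (m m' : Fin M)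
    (h : ∑ n ∈ S, B.mean (x n) m < ∑ n ∈ S, B.mean (x n) m' + δ) :
    ∑ n ∈ S, B.mean (x n) m ≤ ∑ n ∈ S, B.mean (x n) m' := by
  obtain ⟨Δ, hΔ, hj⟩ := hD
  choose j _ hj using hj
  simp only [hj, ← Finset.sum_mul, ← Nat.cast_sum] at h ⊢
  have hΔ0 : 0 < Δ := hδ.trans_le hΔ
  refine mul_le_mul_of_nonneg_right ?_ hΔ0.le
  by_contra hcon
  push Not at hcon
  have h1 : (∑ n ∈ S, j (x n) m') + 1 ≤ ∑ n ∈ S, j (x n) m := by exact_mod_cast hcon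
  have h2 : ((∑ n ∈ S, j (x n) m' : ℕ) : ℝ) + 1 ≤ (∑ n ∈ S, j (x n) m : ℕ) := by
    exact_mod_cast h1
  nlinarith

theorem sum_mean_le_of_accurate (B : BroadcastBandit M N K τ) {δ ε : ℝ} (hδ : 0 < δ)
    (hD : B.DiscretePayoffs δ) (hε : 0 < ε) (L : ℕ) {t : ℕ} (h : Fin t → Observation M N K τ)
    (x : Fin N → Fin K) (g : Fin N → Fin τ) (s : Fin τ)
    (hcard : (Finset.univ.filter fun n => g n = s).card * ε ≤ δ / 2)
    (hacc : ∀ n, g n = s → ∀ m, B.Accurate L ε h (x n) m) (d m : Fin M) :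
    ∑ n ∈ Finset.univ.filter (fun n => g n = s), B.mean (x n) m ≤
      ∑ n ∈ Finset.univ.filter (fun n => g n = s), B.mean (x n)
        (pickMax d fun m₁ m₂ => score L h x g s m₁ ≤ score L h x g s m₂) := by
  set S := Finset.univ.filter fun n => g n = s with hS
  set p := pickMax d fun m₁ m₂ => score L h x g s m₁ ≤ score L h x g s m₂ with hp
  rcases S.eq_empty_or_nonempty with hSe | hSn
  · simp [hSe]
  have hclose : ∀ m, |score L h x g s m - ∑ n ∈ S, B.mean (x n) m| < δ / 2 := by
    intro m
    rw [score, ← Finset.sum_sub_distrib]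
    refine (Finset.abs_sum_le_sum_abs _ _).trans_lt (lt_of_lt_of_le ?_ hcard)
    rw [← nsmul_eq_mul, ← Finset.sum_const]
    refine Finset.sum_lt_sum_of_nonempty hSn fun n hn => ?_
    exact (hacc n (by simpa [hS] using hn) m).abs_sub_lt hε.le
  refine hD.sum_le_of_sum_lt_add hδ S x m p ?_
  have h1 := abs_lt.1 (hclose m)
  have h2 := abs_lt.1 (hclose p)
  have h3 : score L h x g s m ≤ score L h x g s p := le_pickMax d (score L h x g s) m
  linarith [h1.1, h2.2]

-- A subgroup without inaccurate pairs loses nothing; any other loses at most its size, which is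
-- charged to one user with an inaccurate pair. Each summand on the right involves the context of a
-- single user, so its expectation needs only the uniform marginal.
open scoped Classical in
theorem best_sub_le_of_balanced (B : BroadcastBandit M N K τ) {δ ε : ℝ} (hδ : 0 < δ)
    (hD : B.DiscretePayoffs δ) (hε : 0 < ε) (hG : ((N / τ + 1 : ℕ) : ℝ) * ε ≤ δ / 2) (L : ℕ)
    {t : ℕ} (h : Fin t → Observation M N K τ) (x : Fin N → Fin K) {g : Fin N → Fin τ}
    (hg : IsBalanced g) (d : Fin M) :
    B.best x g - ∑ n, B.mean (x n)
        (pickMax d fun m₁ m₂ => score L h x g (g n) m₁ ≤ score L h x g (g n) m₂) ≤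
      ∑ n, (N / τ + 1 : ℕ) * ∑ m, (if B.Accurate L ε h (x n) m then (0 : ℝ) else 1) := by
  have : Nonempty (Fin M) := ⟨d⟩
  rw [best, ← Finset.sum_fiberwise (Finset.univ : Finset (Fin N)) g,
    ← Finset.sum_fiberwise (Finset.univ : Finset (Fin N)) g, ← Finset.sum_sub_distrib]
  refine Finset.sum_le_sum fun s _ => ?_
  have hcard : (Finset.univ.filter fun n => g n = s).card ≤ N / τ + 1 := by
    rcases hg s with h | h <;> omega
  have hcard' : ((Finset.univ.filter fun n => g n = s).card : ℝ) ≤ (N / τ + 1 : ℕ) := by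
    exact_mod_cast hcard
  have e : ∑ n ∈ Finset.univ.filter (fun n => g n = s), B.mean (x n)
      (pickMax d fun m₁ m₂ => score L h x g (g n) m₁ ≤ score L h x g (g n) m₂) =
      ∑ n ∈ Finset.univ.filter (fun n => g n = s), B.mean (x n)
        (pickMax d fun m₁ m₂ => score L h x g s m₁ ≤ score L h x g s m₂) :=
    Finset.sum_congr rfl fun n hn => by rw [(Finset.mem_filter.1 hn).2]
  rw [e]
  have hnn : ∀ n, 0 ≤ ((N / τ + 1 : ℕ) : ℝ) *
      ∑ m, (if B.Accurate L ε h (x n) m then (0 : ℝ) else 1) := fun n =>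
    mul_nonneg (by positivity) (Finset.sum_nonneg fun m _ => by split_ifs <;> norm_num)
  by_cases hacc : ∀ n, g n = s → ∀ m, B.Accurate L ε h (x n) m
  · refine le_trans ?_ (Finset.sum_nonneg fun n _ => hnn n)
    rw [sub_nonpos]
    refine ciSup_le fun m => B.sum_mean_le_of_accurate hδ hD hε L h x g s ?_ hacc d m
    exact (mul_le_mul_of_nonneg_right hcard' hε.le).trans hG
  · push Not at hacc
    obtain ⟨n, hn, m, hm⟩ := hacc
    have h1 : (⨆ m, ∑ n ∈ Finset.univ.filter (fun n => g n = s), B.mean (x n) m) ≤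
        (N / τ + 1 : ℕ) := by
      refine ciSup_le fun m => (Finset.sum_le_card_nsmul _ _ 1 fun n _ => (B.mean_mem _ _).2).trans ?_
      simpa using hcard'
    have h2 : 0 ≤ ∑ n ∈ Finset.univ.filter (fun n => g n = s), B.mean (x n)
        (pickMax d fun m₁ m₂ => score L h x g s m₁ ≤ score L h x g s m₂) :=
      Finset.sum_nonneg fun n _ => (B.mean_mem _ _).1
    have h3 : (1 : ℝ) ≤ ∑ m, (if B.Accurate L ε h (x n) m then (0 : ℝ) else 1) := by
      refine le_trans ?_ (Finset.single_le_sum (fun m _ => by split_ifs <;> norm_num)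
        (Finset.mem_univ m))
      rw [if_neg hm]
    have h4 := Finset.single_le_sum (s := Finset.univ.filter fun n => g n = s)
      (fun n _ => hnn n) (a := n) (by simpa using hn)
    have h5 : ((N / τ + 1 : ℕ) : ℝ) * 1 ≤ _ := mul_le_mul_of_nonneg_left h3 (by positivity)
    linarith

open scoped Classical in
theorem integral_slotLoss_exploit_le (B : BroadcastBandit M N K τ) (hB : B.UniformArrivals)
    {δ ε : ℝ} (hδ : 0 < δ) (hD : B.DiscretePayoffs δ) (hε : 0 < ε)
    (hG : ((N / τ + 1 : ℕ) : ℝ) * ε ≤ δ / 2) (a : ℕ → Fin τ → Fin M) {L t : ℕ} (hLt : L ≤ t)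
    (h : Fin t → Observation M N K τ) (d : Fin M) :
    ∫ z : Slot M N K τ, B.slotLoss z ((exploreCommit a L d).choose t h z.1 z.2.1) ∂B.slotLaw ≤
      ∑ k, ∑ m, ((N / τ + 1 : ℕ) : ℝ) * N / K * (if B.Accurate L ε h k m then (0 : ℝ) else 1) := by
  set w : Fin K → ℝ := fun k =>
    (N / τ + 1 : ℕ) * ∑ m, (if B.Accurate L ε h k m then (0 : ℝ) else 1) with hw
  rw [B.integral_slotLoss_eq fun x g => (exploreCommit a L d).choose t h x g]
  calc _ ≤ ∫ z : Slot M N K τ, ∑ n, w (z.1 n) ∂B.slotLaw := by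
        refine integral_mono_ae (B.integrable_slot_of_finite fun x g => B.best x g -
          ∑ n, B.mean (x n) ((exploreCommit a L d).choose t h x g (g n)))
          (B.integrable_slot_of_finite fun x g => ∑ n, w (x n)) ?_
        filter_upwards [B.ae_slotLaw_balanced] with z hz
        simp only [exploreCommit, hLt.not_gt, if_false]
        exact B.best_sub_le_of_balanced hδ hD hε hG L h z.1 hz d
    _ = N * ∑ k, (K : ℝ)⁻¹ * w k := by
        rw [integral_finsetSum _ fun n _ => B.integrable_slot_of_finite fun x g => w (x n)]
        simp [B.integral_slot_context hB w]
    _ = _ := by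
        simp only [hw, Finset.mul_sum]
        refine Finset.sum_congr rfl fun k _ => Finset.sum_congr rfl fun m _ => ?_
        rw [div_eq_mul_inv]
        ring

theorem measurable_slotLoss_choose (B : BroadcastBandit M N K τ) (π : Strategy M N K τ) (t : ℕ) :
    Measurable fun p : (Fin t → Observation M N K τ) × Slot M N K τ =>
      B.slotLoss p.2 (π.choose t p.1 p.2.1 p.2.2.1) := by
  have hc : Measurable fun p : (Fin t → Observation M N K τ) × Slot M N K τ =>
      π.choose t p.1 p.2.1 p.2.2.1 :=
    (π.measurable_choose t).comp (by fun_prop :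
      Measurable fun p : (Fin t → Observation M N K τ) × Slot M N K τ => (p.1, p.2.1, p.2.2.1))
  have hb : Measurable fun q : (Fin N → Fin K) × (Fin N → Fin τ) => B.best q.1 q.2 :=
    measurable_of_finite _
  have hp : Measurable fun p : (Fin t → Observation M N K τ) × Slot M N K τ =>
      (p.2.1, p.2.2.1) := by fun_prop
  have ho : Measurable fun p : (Fin t → Observation M N K τ) × Slot M N K τ =>
      Strategy.observe p.2 (π.choose t p.1 p.2.1 p.2.2.1) :=
    Strategy.measurable_observe.comp (measurable_snd.prodMk hc)
  have hs : ∀ n, Measurable fun p : (Fin t → Observation M N K τ) × Slot M N K τ =>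
      p.2.2.2 n (p.2.1 n) (π.choose t p.1 p.2.1 p.2.2.1 (p.2.2.1 n)) :=
    fun n => (measurable_pi_apply n).comp ho.snd.snd.snd
  exact (hb.comp hp).sub (Finset.measurable_sum _ fun n _ => hs n)

theorem integral_slotLoss_eq_integral_history (B : BroadcastBandit M N K τ)
    (π : Strategy M N K τ) (t : ℕ) :
    Integrable (fun h => ∫ z : Slot M N K τ, B.slotLoss z (π.choose t h z.1 z.2.1) ∂B.slotLaw)
      (B.law.map fun ω => π.history ω t) ∧
    ∫ ω, B.slotLoss (ω t) (π.message ω t) ∂B.law =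
      ∫ h, ∫ z : Slot M N K τ, B.slotLoss z (π.choose t h z.1 z.2.1) ∂B.slotLaw
        ∂(B.law.map fun ω => π.history ω t) := by
  set F : (Fin t → Observation M N K τ) × Slot M N K τ → ℝ :=
    fun p => B.slotLoss p.2 (π.choose t p.1 p.2.1 p.2.2.1) with hF
  have hFm : Measurable F := B.measurable_slotLoss_choose π t
  have hmap := B.map_history_eval π t
  have hpair : Measurable fun ω : ℕ → Slot M N K τ => (π.history ω t, ω t) :=
    (π.measurable_history t).prodMk (measurable_pi_apply t)
  have hi : Integrable F ((B.law.map fun ω => π.history ω t).prod B.slotLaw) := by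
    rw [← hmap, integrable_map_measure hFm.aestronglyMeasurable hpair.aemeasurable]
    exact B.integrable_slotLoss π t
  have : IsProbabilityMeasure (B.law.map fun ω => π.history ω t) :=
    Measure.isProbabilityMeasure_map (π.measurable_history t).aemeasurable
  refine ⟨hi.integral_prod_left, ?_⟩
  rw [← integral_prod F hi, ← hmap, integral_map hpair.aemeasurable hFm.aestronglyMeasurable]
  rfl

theorem integral_slotLoss_exploreCommit_le (B : BroadcastBandit M N K τ)
    (hB : B.UniformArrivals) {δ ε : ℝ} (hδ : 0 < δ) (hD : B.DiscretePayoffs δ) (hε : 0 < ε)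
    (hε' : ε ≤ 1 / 2) (hG : ((N / τ + 1 : ℕ) : ℝ) * ε ≤ δ / 2) (a : ℕ → Fin τ → Fin M)
    {L q t : ℕ} (hLt : L ≤ t)
    (hq : ∀ m, q ≤ ∑ t ∈ Finset.range L, (Finset.univ.filter fun s => a t s = m).card)
    (hK : 0 < K) (d : Fin M) :
    ∫ ω, B.slotLoss (ω t) ((exploreCommit a L d).message ω t) ∂B.law ≤
      (N / τ + 1 : ℕ) * N * M * (2 * Real.exp (-(ε ^ 2 / K * ((N / τ : ℕ) * q)))) := by
  classical
  set π : Strategy M N K τ := exploreCommit a L d with hπ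
  set ν := B.law.map fun ω => π.history ω t with hν
  have : IsProbabilityMeasure ν :=
    Measure.isProbabilityMeasure_map (π.measurable_history t).aemeasurable
  obtain ⟨hi, he⟩ := B.integral_slotLoss_eq_integral_history π t
  -- Only the failure indicators depend on the history; integrating them turns the bound at a fixed
  -- history into failure probabilities.
  have hind : ∀ k m, Integrable (fun h : Fin t → Observation M N K τ =>
      ((N / τ + 1 : ℕ) : ℝ) * N / K * (if B.Accurate L ε h k m then (0 : ℝ) else 1)) ν := by
    intro k m
    refine Integrable.const_mul ?_ _
    have e : (fun h : Fin t → Observation M N K τ =>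
        if B.Accurate L ε h k m then (0 : ℝ) else 1) =
        Set.indicator {h | ¬ B.Accurate L ε h k m} fun _ => 1 := by
      funext h
      by_cases hh : B.Accurate L ε h k m <;> simp [hh]
    rw [e]
    exact (integrable_const _).indicator (B.measurableSet_not_accurate L t ε k m)
  have hval : ∀ k m, ∫ h : Fin t → Observation M N K τ,
      (if B.Accurate L ε h k m then (0 : ℝ) else 1) ∂ν ≤
      2 * Real.exp (-(ε ^ 2 / K * ((N / τ : ℕ) * q))) := by
    intro k m
    have e : (fun h : Fin t → Observation M N K τ =>
        if B.Accurate L ε h k m then (0 : ℝ) else 1) =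
        Set.indicator {h | ¬ B.Accurate L ε h k m} 1 := by
      funext h
      by_cases hh : B.Accurate L ε h k m <;> simp [hh]
    rw [e, integral_indicator_one (B.measurableSet_not_accurate L t ε k m), hν,
      map_measureReal_apply (π.measurable_history t) (B.measurableSet_not_accurate L t ε k m)]
    exact B.measure_not_accurate_le hB a hLt d k m (hq m) hε.le hε'
  have hK' : (0 : ℝ) < K := by exact_mod_cast hK
  rw [he]
  calc _ ≤ ∫ h, ∑ k, ∑ m, ((N / τ + 1 : ℕ) : ℝ) * N / K *
          (if B.Accurate L ε h k m then (0 : ℝ) else 1) ∂ν :=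
        integral_mono hi (integrable_finsetSum _ fun k _ => integrable_finsetSum _ fun m _ =>
          hind k m) fun h => B.integral_slotLoss_exploit_le hB hδ hD hε hG a hLt h d
    _ = ∑ k, ∑ m, ((N / τ + 1 : ℕ) : ℝ) * N / K * ∫ h,
          (if B.Accurate L ε h k m then (0 : ℝ) else 1) ∂ν := by
        rw [integral_finsetSum _ fun k _ => integrable_finsetSum _ fun m _ => hind k m]
        refine Finset.sum_congr rfl fun k _ => ?_
        rw [integral_finsetSum _ fun m _ => hind k m]
        exact Finset.sum_congr rfl fun m _ => integral_const_mul _ _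
    _ ≤ ∑ k : Fin K, ∑ m : Fin M, ((N / τ + 1 : ℕ) : ℝ) * N / K *
          (2 * Real.exp (-(ε ^ 2 / K * ((N / τ : ℕ) * q)))) :=
        Finset.sum_le_sum fun k _ => Finset.sum_le_sum fun m _ =>
          mul_le_mul_of_nonneg_left (hval k m) (by positivity)
    _ = _ := by
        simp only [Finset.sum_const, Finset.card_univ, Fintype.card_fin, nsmul_eq_mul]
        field_simp

theorem regret_exploreCommit_le (B : BroadcastBandit M N K τ)
    (hB : B.UniformArrivals) {δ ε : ℝ} (hδ : 0 < δ) (hD : B.DiscretePayoffs δ) (hε : 0 < ε)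
    (hε' : ε ≤ 1 / 2) (hG : ((N / τ + 1 : ℕ) : ℝ) * ε ≤ δ / 2) (a : ℕ → Fin τ → Fin M)
    {L q : ℕ} (hq : ∀ m, q ≤ ∑ t ∈ Finset.range L, (Finset.univ.filter fun s => a t s = m).card)
    (hK : 0 < K) (d : Fin M) (T : ℕ) :
    B.regret (exploreCommit a L d) T ≤ L * N +
      T * ((N / τ + 1 : ℕ) * N * M * (2 * Real.exp (-(ε ^ 2 / K * ((N / τ : ℕ) * q))))) := by
  set P : ℝ := (N / τ + 1 : ℕ) * N * M * (2 * Real.exp (-(ε ^ 2 / K * ((N / τ : ℕ) * q))))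
    with hP
  have hP0 : 0 ≤ P := by positivity
  rw [regret_eq_sum]
  -- Charging `P` in every timeslot is harmless and avoids comparing `L` with `T`.
  calc _ ≤ ∑ t ∈ Finset.range T, ((if t < L then (N : ℝ) else 0) + P) := by
        refine Finset.sum_le_sum fun t _ => ?_
        split_ifs with ht
        · exact (B.integral_slotLoss_le d _ t).trans (by linarith)
        · rw [zero_add]
          exact B.integral_slotLoss_exploreCommit_le hB hδ hD hε hε' hG a (not_lt.1 ht) hq hK d
    _ ≤ _ := by
        rw [Finset.sum_add_distrib, ← Finset.sum_filter, Finset.sum_const, Finset.sum_const,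
          Finset.card_range, nsmul_eq_mul, nsmul_eq_mul]
        gcongr
        refine (Finset.card_le_card (t := Finset.range L) fun t ht => ?_).trans
          (Finset.card_range L).le
        simp only [Finset.mem_filter, Finset.mem_range] at ht ⊢
        exact ht.2

end BroadcastBandit

/-! ### The cyclic schedule -/

namespace Strategy

variable {M N K τ : ℕ}

/-- The schedule that sends the messages in cyclic order, one to each subgroup. -/
def roundRobin (τ : ℕ) (hM : 0 < M) (t : ℕ) (s : Fin τ) : Fin M :=
  ⟨(t * τ + s) % M, Nat.mod_lt _ hM⟩

/-- Number the transmissions by `t * τ + s`. Message `m` occupies the numbers `m + M * i`, and those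
with `i < q` lie below `M * q ≤ L * τ`. -/
theorem le_sum_card_roundRobin (hM : 0 < M) (hτ : 0 < τ) {L q : ℕ} (h : M * q ≤ L * τ)
    (m : Fin M) :
    q ≤ ∑ t ∈ Finset.range L, (Finset.univ.filter fun s => roundRobin τ hM t s = m).card := by
  rw [← Finset.card_sigma, ← Finset.card_range q]
  refine Finset.card_le_card_of_injOn
    (fun i => ⟨(m + M * i) / τ, ⟨(m + M * i) % τ, Nat.mod_lt _ hτ⟩⟩) ?_ ?_
  · intro i hi
    have hi' : i < q := by simpa using hi
    have hlt : m + M * i < L * τ := by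
      have h1 : M * (i + 1) ≤ M * q := Nat.mul_le_mul_left _ hi'
      have h2 := m.isLt
      rw [Nat.mul_add] at h1
      omega
    have he : (m + M * i) / τ * τ + (m + M * i) % τ = m + M * i := Nat.div_add_mod' _ _
    refine Finset.mem_coe.2 (Finset.mem_sigma.2 ⟨Finset.mem_range.2 ((Nat.div_lt_iff_lt_mul hτ).2 hlt),
      Finset.mem_filter.2 ⟨Finset.mem_univ _, Fin.ext ?_⟩⟩)
    simp only [roundRobin, he, Nat.add_mul_mod_self_left]
    exact Nat.mod_eq_of_lt m.isLt
  · intro i _ j _ hij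
    simp only [Sigma.mk.injEq, heq_eq_eq, Fin.mk.injEq] at hij
    have h1 := Nat.div_add_mod (m + M * i) τ
    have h2 := Nat.div_add_mod (m + M * j) τ
    rw [hij.1, hij.2, h2] at h1
    have h3 : M * j = M * i := by omega
    exact (Nat.eq_of_mul_eq_mul_left hM h3).symm

end Strategy

/-! ### Choice of precision and exploration length -/

namespace BroadcastBandit

open Strategy

variable {M N K τ : ℕ}

theorem DiscretePayoffs.le_one {B : BroadcastBandit M N K τ} {δ : ℝ} (hδ : 0 < δ)
    (hD : B.DiscretePayoffs δ) (k : Fin K) (m : Fin M) : δ ≤ 1 := by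
  obtain ⟨Δ, hΔ, h⟩ := hD
  obtain ⟨j, hj, he⟩ := h k m
  have h1 := (B.mean_mem k m).2
  have h2 : (1 : ℝ) ≤ j := by exact_mod_cast hj
  nlinarith

/-- The terms `N` and `M * (N / τ)` pay for rounding up `L` and `q`. Keeping `Λ` free lets both
regimes use the same bound. -/
theorem exists_strategy_regret_le {δ : ℝ} (hδ : 0 < δ) (hM : 0 < M) (hK : 0 < K) (hτ : 1 ≤ τ)
    (hN : τ ≤ N) {Λ : ℝ} (hΛ : 0 ≤ Λ) (T : ℕ) :
    ∃ π : Strategy M N K τ, ∀ B : BroadcastBandit M N K τ,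
      B.UniformArrivals → B.DiscretePayoffs δ →
      B.regret π T ≤ N + M * (N / τ : ℝ) + 32 / δ ^ 2 * (M * K * (N / τ : ℝ) ^ 2 * Λ) +
        4 * T * N * M * (N / τ : ℝ) * Real.exp (-Λ) := by
  -- Means are at most `1`, so no instance exists for `δ > 1`; otherwise `ε ≤ 1 / 2` follows from `δ
  -- ≤ 1 ≤ G`.
  by_cases hδ1 : 1 < δ
  · refine ⟨exploreCommit (roundRobin τ hM) 0 ⟨0, hM⟩, fun B _ hD => ?_⟩
    exact absurd (hD.le_one hδ ⟨0, hK⟩ ⟨0, hM⟩) (not_le.2 hδ1)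
  push Not at hδ1
  set f : ℕ := N / τ with hf
  set ρ : ℝ := N / τ with hρ
  have hf1 : 1 ≤ f := (Nat.one_le_div_iff (by omega)).2 hN
  have hf1' : (1 : ℝ) ≤ f := by exact_mod_cast hf1
  have hτ' : (0 : ℝ) < τ := by exact_mod_cast hτ
  have hM' : (0 : ℝ) < M := by exact_mod_cast hM
  have hK' : (0 : ℝ) < K := by exact_mod_cast hK
  have hfρ : (f : ℝ) ≤ ρ := Nat.cast_div_le
  have hρf : ρ < f + 1 := by
    rw [hρ, div_lt_iff₀ hτ']
    have h1 : N < (f + 1) * τ := by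
      rw [mul_comm]
      exact Nat.lt_mul_div_succ N (by omega)
    exact_mod_cast h1
  have hρ0 : 0 < ρ := by linarith
  set G : ℝ := ((f + 1 : ℕ) : ℝ) with hG
  have hGe : G = f + 1 := by simp [hG]
  have hGρ : G ≤ 2 * ρ := by rw [hGe]; linarith
  have hG1 : 1 ≤ G := by rw [hGe]; linarith
  set ε : ℝ := δ / (2 * G) with hε
  have hε0 : 0 < ε := by positivity
  have hε1 : ε ≤ 1 / 2 := by
    rw [hε, div_le_div_iff₀ (by positivity) (by norm_num)]
    linarith
  have hεG : G * ε ≤ δ / 2 := by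
    rw [hε]
    field_simp
    exact le_rfl
  -- The least `q` for which the Chernoff exponent `ε ^ 2 * f * q / K` reaches `Λ`.
  set q : ℕ := ⌈K * Λ / (ε ^ 2 * f)⌉₊ with hq
  set L : ℕ := ⌈(M * q : ℝ) / τ⌉₊ with hL
  have hden : 0 < ε ^ 2 * f := by positivity
  have hq1 : K * Λ / (ε ^ 2 * f) ≤ q := Nat.le_ceil _
  have hq2 : (q : ℝ) ≤ K * Λ / (ε ^ 2 * f) + 1 := (Nat.ceil_lt_add_one (by positivity)).le
  have hL1 : (M * q : ℝ) / τ ≤ L := Nat.le_ceil _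
  have hL2 : (L : ℝ) ≤ (M * q : ℝ) / τ + 1 := (Nat.ceil_lt_add_one (by positivity)).le
  have hMq : M * q ≤ L * τ := by
    rw [div_le_iff₀ hτ'] at hL1
    exact_mod_cast hL1
  have hexp : Real.exp (-(ε ^ 2 / K * (f * q))) ≤ Real.exp (-Λ) := by
    rw [Real.exp_le_exp, neg_le_neg_iff]
    rw [div_le_iff₀ hden] at hq1
    rw [div_mul_eq_mul_div, le_div_iff₀ hK']
    linarith
  have hinv : 1 / (ε ^ 2 * f) ≤ 32 / δ ^ 2 * ρ := by
    rw [hε, div_le_iff₀ hden, hε]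
    have e : 32 / δ ^ 2 * ρ * ((δ / (2 * G)) ^ 2 * f) = 8 * ρ * f / G ^ 2 := by
      field_simp
      ring
    rw [e, le_div_iff₀ (by positivity)]
    nlinarith
  refine ⟨exploreCommit (roundRobin τ hM) L ⟨0, hM⟩, fun B hB hD => ?_⟩
  have hmain := B.regret_exploreCommit_le hB hδ hD hε0 hε1 hεG (roundRobin τ hM)
    (le_sum_card_roundRobin hM hτ hMq) hK ⟨0, hM⟩ T
  refine hmain.trans (add_le_add ?_ ?_)
  · calc (L : ℝ) * N ≤ ((M * q : ℝ) / τ + 1) * N := by gcongr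
      _ = N + M * ρ * q := by rw [hρ]; field_simp; ring
      _ ≤ N + M * ρ * (K * Λ / (ε ^ 2 * f) + 1) := by gcongr
      _ = N + M * ρ + M * ρ * (K * Λ) * (1 / (ε ^ 2 * f)) := by field_simp; ring
      _ ≤ N + M * ρ + M * ρ * (K * Λ) * (32 / δ ^ 2 * ρ) := by gcongr
      _ = _ := by ring
  · calc (T : ℝ) * (G * N * M * (2 * Real.exp (-(ε ^ 2 / K * (f * q)))))
        ≤ T * (2 * ρ * N * M * (2 * Real.exp (-Λ))) := by gcongr
      _ = _ := by ring

end BroadcastBandit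

/-! ### The two regimes -/

open BroadcastBandit

theorem exists_strategy_regret_le_of_lt {δ : ℝ} (hδ : 0 < δ) {M N K τ T : ℕ} (hM : 0 < M)
    (hK : 0 < K) (hτ : 1 ≤ τ) (hN : τ < N)
    (hF : (N : ℝ) ≤ M * N ^ 2 * K / τ ^ 2 * Real.log (M * N * K * T)) :
    ∃ π : Strategy M N K τ, ∀ B : BroadcastBandit M N K τ,
      B.UniformArrivals → B.DiscretePayoffs δ →
      B.regret π T ≤
        (11 + 64 / δ ^ 2) * (M * N ^ 2 * K / τ ^ 2 * Real.log (M * N * K * T)) := by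
  have hN2 : (2 : ℝ) ≤ N := by exact_mod_cast (by omega : 2 ≤ N)
  -- For `T = 0` the convention `log 0 = 0` would make the right side of `hF` vanish.
  have hT : 0 < T := by
    rcases Nat.eq_zero_or_pos T with rfl | h
    · simp only [Nat.cast_zero, mul_zero, Real.log_zero] at hF
      linarith
    · exact h
  have hM' : (1 : ℝ) ≤ M := by exact_mod_cast hM
  have hK' : (1 : ℝ) ≤ K := by exact_mod_cast hK
  have hT' : (1 : ℝ) ≤ T := by exact_mod_cast hT
  have hτ' : (1 : ℝ) ≤ τ := by exact_mod_cast hτ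
  have hNτ : (τ : ℝ) ≤ N := by exact_mod_cast hN.le
  set X : ℝ := M * N * K * T with hX
  have hX2 : 2 ≤ X := by
    have h1 : (1 : ℝ) ≤ M * K * T := one_le_mul_of_one_le_of_one_le
      (one_le_mul_of_one_le_of_one_le hM' hK') hT'
    calc (2 : ℝ) ≤ N * 1 := by linarith
      _ ≤ N * (M * K * T) := by gcongr
      _ = X := by rw [hX]; ring
  have hlog : 1 / 2 ≤ Real.log X := by
    have h1 := Real.log_le_log (by norm_num) hX2
    have h2 := Real.log_two_gt_d9
    linarith
  obtain ⟨π, hπ⟩ := exists_strategy_regret_le (N := N) (τ := τ) hδ hM hK hτ hN.le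
    (Λ := 2 * Real.log X) (by linarith) T
  refine ⟨π, fun B hB hD => (hπ B hB hD).trans ?_⟩
  set ρ : ℝ := N / τ with hρ
  have hρ1 : 1 ≤ ρ := (one_le_div (by linarith)).2 hNτ
  have hρN : ρ ≤ N := div_le_self (by linarith) hτ'
  have hFe : M * N ^ 2 * K / τ ^ 2 * Real.log X = M * K * ρ ^ 2 * Real.log X := by
    rw [hρ]; field_simp
  rw [hFe] at hF ⊢
  set F : ℝ := M * K * ρ ^ 2 * Real.log X with hFdef
  have hMρ : M * ρ ≤ 2 * F := by
    calc M * ρ = M * 1 * (1 * ρ) * 1 := by ring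
      _ ≤ M * K * (ρ * ρ) * (2 * Real.log X) := by gcongr; linarith
      _ = 2 * F := by rw [hFdef]; ring
  have hexp : Real.exp (-(2 * Real.log X)) = 1 / X ^ 2 := by
    rw [Real.exp_neg, two_mul, Real.exp_add, Real.exp_log (by linarith)]
    ring
  -- With `Λ = 2 * log X` the failure factor is `1 / X ^ 2`, and `X ^ 2` dominates `T * N * M * ρ`
  -- because `ρ ≤ N`.
  have hlast : 4 * T * N * M * ρ * Real.exp (-(2 * Real.log X)) ≤ 4 * F := by
    rw [hexp, mul_one_div, div_le_iff₀ (by positivity)]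
    have hFN : 1 ≤ F := by linarith
    calc 4 * T * N * M * ρ ≤ 4 * T * N * M * N := by gcongr
      _ = 4 * 1 * (N ^ 2 * (M * 1) * (T * 1) * 1) := by ring
      _ ≤ 4 * F * (N ^ 2 * (M * M) * (T * T) * K ^ 2) := by
        gcongr
        exact one_le_pow₀ hK'
      _ = 4 * F * X ^ 2 := by rw [hX]; ring
  have hmid : 32 / δ ^ 2 * (M * K * ρ ^ 2 * (2 * Real.log X)) = 64 / δ ^ 2 * F := by
    rw [hFdef]; ring
  rw [hmid]
  have hF0 : 0 ≤ F := by linarith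
  linarith

theorem exists_strategy_regret_le_of_eq {δ : ℝ} (hδ : 0 < δ) {M N K T : ℕ} (hM : 0 < M)
    (hK : 0 < K) (hN : 1 ≤ N) (hT : 2 * K ≤ N * T)
    (hF : (N : ℝ) ≤ M * K * Real.log (N * T / K)) :
    ∃ π : Strategy M N K N, ∀ B : BroadcastBandit M N K N,
      B.UniformArrivals → B.DiscretePayoffs δ →
      B.regret π T ≤ (11 + 64 / δ ^ 2) * (M * K * Real.log (N * T / K)) := by
  have hM' : (1 : ℝ) ≤ M := by exact_mod_cast hM
  have hK' : (1 : ℝ) ≤ K := by exact_mod_cast hK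
  have hN' : (1 : ℝ) ≤ N := by exact_mod_cast hN
  set X : ℝ := N * T / K with hX
  have hX2 : 2 ≤ X := by
    rw [hX, le_div_iff₀ (by linarith)]
    exact_mod_cast hT
  have hlog : 1 / 2 ≤ Real.log X := by
    have h1 := Real.log_le_log (by norm_num) hX2
    have h2 := Real.log_two_gt_d9
    linarith
  obtain ⟨π, hπ⟩ := exists_strategy_regret_le (N := N) (τ := N) hδ hM hK hN le_rfl
    (Λ := Real.log X) (by linarith) T
  refine ⟨π, fun B hB hD => (hπ B hB hD).trans ?_⟩
  rw [div_self (by linarith : (N : ℝ) ≠ 0), Real.exp_neg, Real.exp_log (by linarith)]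
  set F : ℝ := M * K * Real.log X with hFdef
  have hMK : M * K ≤ 2 * F := by
    rw [hFdef]
    nlinarith [mul_pos (by linarith : (0 : ℝ) < M) (by linarith : (0 : ℝ) < K)]
  have hMle : (M : ℝ) * 1 ≤ M * K := by gcongr
  -- Here `Λ = log X` suffices: `X = N * T / K` cancels `N * T` and leaves a term of at most `8 *
  -- F`. With `N ≤ F` and `M ≤ 2 * F` this gives the constant `11`.
  have hlast : 4 * T * N * M * 1 * X⁻¹ = 4 * (M * K) := by
    have hX0 : X ≠ 0 := by linarith
    have e : (N : ℝ) * T = X * K := by rw [hX]; field_simp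
    calc 4 * T * N * M * 1 * X⁻¹ = 4 * (N * T) * M * X⁻¹ := by ring
      _ = _ := by rw [e]; field_simp
  have hmid : 32 / δ ^ 2 * (M * K * 1 ^ 2 * Real.log X) ≤ 64 / δ ^ 2 * F := by
    have hF0 : 0 ≤ F := by linarith
    rw [one_pow, mul_one]
    exact mul_le_mul_of_nonneg_right (by gcongr; norm_num) hF0
  rw [hlast]
  linarith

theorem theorem2 (δ : ℝ) (hδ : 0 < δ) :
    ∃ C : ℝ, 0 < C ∧ ∀ M N K τ T : ℕ, 0 < M → 0 < K → 1 ≤ τ →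
      (τ < N →
        (N : ℝ) ≤ M * N ^ 2 * K / τ ^ 2 * Real.log (M * N * K * T) →
        ∃ π : Strategy M N K τ, ∀ B : BroadcastBandit M N K τ,
          B.UniformArrivals → B.DiscretePayoffs δ →
          B.regret π T ≤ C * (M * N ^ 2 * K / τ ^ 2 * Real.log (M * N * K * T))) ∧
      (τ = N →
        2 * K ≤ N * T →
        (N : ℝ) ≤ M * K * Real.log (N * T / K) →
        ∃ π : Strategy M N K τ, ∀ B : BroadcastBandit M N K τ,
          B.UniformArrivals → B.DiscretePayoffs δ →
          B.regret π T ≤ C * (M * K * Real.log (N * T / K))) := by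
  refine ⟨11 + 64 / δ ^ 2, by positivity, fun M N K τ T hM hK hτ => ⟨fun hN hF => ?_, ?_⟩⟩
  · exact exists_strategy_regret_le_of_lt hδ hM hK hτ hN hF
  · rintro rfl hT hF
    exact exists_strategy_regret_le_of_eq hδ hM hK hτ hT hF
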